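/- Let $0<p,q<1$. Let $\mathcal O(S^3_{pq})$ be the universal unital complex $*$-algebra generated by $a$ and $b$ subject to the relations $$a^*a-q\,aa^*=1-q,\qquad b^*b-p\,bb^*=1-p,\qquad ab=ba,\qquad a^*b=ba^*,\qquad (1-aa^*)(1-bb^*)=0,$$ and let $C(S^3_{pq})$ be its enveloping $C^*$-algebra, i.e. the (Hausdorff) completion of $\mathcal O(S^3_{pq})$ with respect to the supremum of $\|\rho(\cdot)\|$ over all $*$-representations $\rho$ by bounded operators on Hilbert spaces. Let $\mathcal T$ be the Toeplitz algebra, i.e. the $C^*$-algebra generated by the unilateral shift $s$, $s e_k=e_{k+1}$, on $\ell^2(\mathbb N)$ with its standard orthonormal basis $(e_k)_{k\ge 0}$, let $\mathcal K$ be the $C^*$-algebra of compact operators on $\ell^2(\mathbb N)$, and let $\pi:\mathcal T\otimes\mathcal T\to(\mathcal T\otimes\mathcal T)/(\mathcal K\otimes\mathcal K)$ be the canonical surjection (tensor products of $C^*$-algebras are spatial). For $r\in(0,1)$ the norm-convergent series $$w_r=\sum_{n=0}^\infty\left(\sqrt{1-r^{n+1}}-\sqrt{1-r^{n}}\right)s^{n+1}s^{*n}$$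 defines an element of $\mathcal T$, namely the weighted shift $w_re_k=\sqrt{1-r^{k+1}}\,e_{k+1}$, $k\ge 0$. Then there is an isomorphism of $C^*$-algebras $\alpha:C(S^3_{pq})\to(\mathcal T\otimes\mathcal T)/(\mathcal K\otimes\mathcal K)$ such that $$\alpha(a)=\pi(w_q\otimes 1),\qquad \alpha(b)=\pi(1\otimes w_p).$$ -/

import Mathlib

open scoped ENNReal TensorProduct lp
open MulOpposite

noncomputable section

/-- The free unital complex `*`-algebra on a set `X`: noncommutative polynomials in the letters
`x = inl x` and `x^* = inr x`. -/
def FreeStarAlgebra (X : Type) : Type := FreeAlgebra ℂ (X ⊕ X)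

namespace FreeStarAlgebra

variable {X : Type}

instance : Ring (FreeStarAlgebra X) := inferInstanceAs (Ring (FreeAlgebra ℂ (X ⊕ X)))
instance : Algebra ℂ (FreeStarAlgebra X) := inferInstanceAs (Algebra ℂ (FreeAlgebra ℂ (X ⊕ X)))

def letter (y : X ⊕ X) : FreeStarAlgebra X := FreeAlgebra.ι ℂ y

/-- The generator attached to `x`. -/
def gen (x : X) : FreeStarAlgebra X := letter (Sum.inl x)

theorem induction {motive : FreeStarAlgebra X → Prop}
    (scalar : ∀ r, motive (algebraMap ℂ (FreeStarAlgebra X) r)) (letter : ∀ y, motive (letter y))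
    (mul : ∀ a b, motive a → motive b → motive (a * b))
    (add : ∀ a b, motive a → motive b → motive (a + b))
    (a : FreeStarAlgebra X) : motive a :=
  FreeAlgebra.induction ℂ (X ⊕ X) scalar letter mul add a

/-- The opposite algebra with scalars acting through complex conjugation. -/
@[reducible] def conjOpAlgebra : Algebra ℂ (FreeStarAlgebra X)ᵐᵒᵖ :=
  ((algebraMap ℂ (FreeStarAlgebra X)ᵐᵒᵖ).comp (starRingEnd ℂ)).toAlgebra' fun c x =>
    Algebra.commutes (R := ℂ) (A := (FreeStarAlgebra X)ᵐᵒᵖ) (starRingEnd ℂ c) x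

/-- The conjugate-linear anti-homomorphism exchanging `x` and `x^*`. -/
def starAux : FreeStarAlgebra X →+* (FreeStarAlgebra X)ᵐᵒᵖ :=
  letI := conjOpAlgebra (X := X)
  (FreeAlgebra.lift ℂ (A := (FreeStarAlgebra X)ᵐᵒᵖ) fun y : X ⊕ X => op (letter y.swap)).toRingHom

theorem starAux_letter (y : X ⊕ X) : starAux (letter y) = op (letter y.swap) :=
  letI := conjOpAlgebra (X := X)
  FreeAlgebra.lift_ι_apply (A := (FreeStarAlgebra X)ᵐᵒᵖ) _ y

theorem starAux_algebraMap (c : ℂ) :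
    starAux (algebraMap ℂ (FreeStarAlgebra X) c) = op (algebraMap ℂ _ (starRingEnd ℂ c)) :=
  letI := conjOpAlgebra (X := X)
  (FreeAlgebra.lift ℂ (A := (FreeStarAlgebra X)ᵐᵒᵖ) fun y : X ⊕ X => op (letter y.swap)).commutes c

instance : StarRing (FreeStarAlgebra X) where
  star x := unop (starAux x)
  star_involutive x := by
    induction x using induction with
    | scalar r => simp [starAux_algebraMap]
    | letter y => simp [starAux_letter]
    | mul a b ha hb => simp only [map_mul, unop_mul, ha, hb]
    | add a b ha hb => simp only [map_add, unop_add, ha, hb]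
  star_mul a b := by simp only [map_mul, unop_mul]
  star_add a b := by simp only [map_add, unop_add]

theorem star_letter (y : X ⊕ X) : star (letter y) = letter y.swap :=
  congrArg unop (starAux_letter y)

theorem star_algebraMap (c : ℂ) :
    star (algebraMap ℂ (FreeStarAlgebra X) c) = algebraMap ℂ _ (star c) :=
  congrArg unop (starAux_algebraMap c)

instance : StarModule ℂ (FreeStarAlgebra X) where
  star_smul c x := by
    rw [Algebra.smul_def, star_mul, star_algebraMap, Algebra.smul_def, Algebra.commutes]

/-- Evaluation of `*`-polynomials at a family of elements of a unital `*`-algebra. -/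
def eval {A : Type*} [Ring A] [StarRing A] [Algebra ℂ A] [StarModule ℂ A] (f : X → A) :
    FreeStarAlgebra X →⋆ₐ[ℂ] A :=
  { (FreeAlgebra.lift ℂ (Sum.elim f fun x => star (f x)) : FreeAlgebra ℂ (X ⊕ X) →ₐ[ℂ] A) with
    map_star' := fun x => by
      let φ : FreeStarAlgebra X →ₐ[ℂ] A := FreeAlgebra.lift ℂ (Sum.elim f fun x => star (f x))
      have hφ : ∀ y, φ (letter y) = Sum.elim f (fun x => star (f x)) y :=
        FreeAlgebra.lift_ι_apply _
      change φ (star x) = star (φ x)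
      induction x using induction with
      | scalar r => rw [star_algebraMap, φ.commutes, φ.commutes, algebraMap_star_comm]
      | letter y => rw [star_letter, hφ, hφ]; cases y <;> simp
      | mul a b ha hb => rw [star_mul, map_mul, map_mul, star_mul, ha, hb]
      | add a b ha hb => rw [star_add, map_add, map_add, star_add, ha, hb] }

theorem eval_gen {A : Type*} [Ring A] [StarRing A] [Algebra ℂ A] [StarModule ℂ A] (f : X → A)
    (x : X) : eval f (gen x) = f x :=
  FreeAlgebra.lift_ι_apply (Sum.elim f fun x => star (f x)) (Sum.inl x)

end FreeStarAlgebra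

/-- The relations between `*`-polynomials generated by `r` together with their adjoints. -/
inductive StarClosure {X : Type} (r : FreeStarAlgebra X → FreeStarAlgebra X → Prop) :
    FreeStarAlgebra X → FreeStarAlgebra X → Prop
  | of {x y} : r x y → StarClosure r x y
  | adjoint {x y} : r x y → StarClosure r (star x) (star y)

theorem StarClosure.star {X : Type} {r : FreeStarAlgebra X → FreeStarAlgebra X → Prop} :
    ∀ x y, StarClosure r x y → StarClosure r (Star.star x) (Star.star y)
  | _, _, .of h => .adjoint h
  | _, _, .adjoint h => by simpa only [star_star] using StarClosure.of h

/-- The universal unital `*`-algebra with generators `X` and relations `r`. -/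
def UniversalStarAlgebra {X : Type} (r : FreeStarAlgebra X → FreeStarAlgebra X → Prop) : Type :=
  (ringConGen (StarClosure r)).Quotient

namespace UniversalStarAlgebra

variable {X : Type} (r : FreeStarAlgebra X → FreeStarAlgebra X → Prop)

instance : Ring (UniversalStarAlgebra r) :=
  inferInstanceAs (Ring (ringConGen (StarClosure r)).Quotient)
instance : Algebra ℂ (UniversalStarAlgebra r) :=
  inferInstanceAs (Algebra ℂ (ringConGen (StarClosure r)).Quotient)

/-- The quotient map from the free `*`-algebra. -/
def mk : FreeStarAlgebra X →ₐ[ℂ] UniversalStarAlgebra r :=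
  RingCon.mkₐ (α := ℂ) (ringConGen (StarClosure r))

theorem mk_surjective : Function.Surjective (mk r) := RingCon.mkₐ_surjective _

theorem mk_eq {x y : FreeStarAlgebra X} (h : r x y) : mk r x = mk r y :=
  (RingCon.eq _).2 (RingConGen.Rel.of _ _ (.of h))

instance : StarRing (UniversalStarAlgebra r) where
  star := Quotient.map' (s₁ := (ringConGen (StarClosure r)).toSetoid)
    (s₂ := (ringConGen (StarClosure r)).toSetoid) star (ringConGen_star StarClosure.star)
  star_involutive x := by
    obtain ⟨x, rfl⟩ := mk_surjective r x
    exact congrArg (mk r) (star_star x)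
  star_mul x y := by
    obtain ⟨x, rfl⟩ := mk_surjective r x
    obtain ⟨y, rfl⟩ := mk_surjective r y
    exact congrArg (mk r) (star_mul x y)
  star_add x y := by
    obtain ⟨x, rfl⟩ := mk_surjective r x
    obtain ⟨y, rfl⟩ := mk_surjective r y
    exact congrArg (mk r) (star_add x y)

theorem star_mk (x : FreeStarAlgebra X) : star (mk r x) = mk r (star x) := rfl

instance : StarModule ℂ (UniversalStarAlgebra r) where
  star_smul c x := by
    obtain ⟨x, rfl⟩ := mk_surjective r x
    exact congrArg (mk r) (star_smul c x)

/-- The image of a generator. -/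
def gen (x : X) : UniversalStarAlgebra r := mk r (FreeStarAlgebra.gen x)

/-- The universal property, existence part. -/
theorem exists_lift {A : Type*} [Ring A] [StarRing A] [Algebra ℂ A] [StarModule ℂ A] (f : X → A)
    (hf : ∀ x y, r x y → FreeStarAlgebra.eval f x = FreeStarAlgebra.eval f y) :
    ∃ φ : UniversalStarAlgebra r →⋆ₐ[ℂ] A, ∀ x, φ (gen r x) = f x := by
  let e : FreeStarAlgebra X →⋆ₐ[ℂ] A := FreeStarAlgebra.eval f
  have H : ringConGen (StarClosure r) ≤ RingCon.ker e.toAlgHom.toRingHom := by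
    refine RingCon.ringConGen_le.2 fun x y h => ?_
    change e x = e y
    cases h with
    | of h => exact hf _ _ h
    | adjoint h => rw [map_star, map_star]; exact congrArg star (hf _ _ h)
  let φ : UniversalStarAlgebra r →ₐ[ℂ] A :=
    RingCon.liftₐ (ringConGen (StarClosure r)) e.toAlgHom H
  have hφ : ∀ x, φ (mk r x) = e x := fun x => rfl
  refine ⟨{ φ with map_star' := fun x => ?_ }, fun x => ?_⟩
  · obtain ⟨x, rfl⟩ := mk_surjective r x
    change φ (star (mk r x)) = star (φ (mk r x))
    rw [star_mk, hφ, hφ, map_star]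
  · exact FreeStarAlgebra.eval_gen f x

end UniversalStarAlgebra

/-- The two generators of the quantum sphere. -/
inductive SphereGen : Type
  | a
  | b

section Sphere

open FreeStarAlgebra in
/-- The defining relations of the coordinate algebra of the quantum 3-sphere with parameters
`p` and `q`. -/
inductive SphereRel (p q : ℝ) : FreeStarAlgebra SphereGen → FreeStarAlgebra SphereGen → Prop
  | disc_a : SphereRel p q
      (star (gen .a) * gen .a - (q : ℂ) • (gen .a * star (gen .a))) ((1 - (q : ℂ)) • 1)
  | disc_b : SphereRel p q
      (star (gen .b) * gen .b - (p : ℂ) • (gen .b * star (gen .b))) ((1 - (p : ℂ)) • 1)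
  | comm : SphereRel p q (gen .a * gen .b) (gen .b * gen .a)
  | star_comm : SphereRel p q (star (gen .a) * gen .b) (gen .b * star (gen .a))
  | sphere : SphereRel p q
      ((1 - gen .a * star (gen .a)) * (1 - gen .b * star (gen .b))) 0

/-- The coordinate `*`-algebra `O(S³_pq)`: the universal unital `*`-algebra generated by `a` and `b`
subject to the relations `SphereRel p q`. -/
abbrev SpherePoly (p q : ℝ) : Type := UniversalStarAlgebra (SphereRel p q)

/-- A bounded `*`-representation of `O(S³_pq)` on a (nonzero) Hilbert space. -/
structure SphereRep (p q : ℝ) : Type 1 where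
  /-- the Hilbert space -/
  H : Type
  [normed : NormedAddCommGroup H]
  [inner : InnerProductSpace ℂ H]
  [complete : CompleteSpace H]
  [nontrivial : Nontrivial H]
  /-- the representation -/
  rep : SpherePoly p q →⋆ₐ[ℂ] (H →L[ℂ] H)

attribute [instance] SphereRep.normed SphereRep.inner SphereRep.complete SphereRep.nontrivial

/-- An element of a `C*`-algebra satisfying the disc relation is a contraction. -/
theorem norm_le_one_of_disc {A : Type*} [CStarAlgebra A] [Nontrivial A] {r : ℝ} (h0 : 0 < r)
    (h1 : r < 1) {x : A} (hx : star x * x - (r : ℂ) • (x * star x) = (1 - (r : ℂ)) • 1) :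
    ‖x‖ ≤ 1 := by
  have h : star x * x = (1 - (r : ℂ)) • 1 + (r : ℂ) • (x * star x) := by rw [← hx]; abel
  have h2 : ‖x‖ * ‖x‖ ≤ (1 - r) + r * (‖x‖ * ‖x‖) := by
    calc ‖x‖ * ‖x‖ = ‖star x * x‖ := CStarRing.norm_star_mul_self.symm
      _ ≤ ‖(1 - (r : ℂ)) • (1 : A)‖ + ‖(r : ℂ) • (x * star x)‖ := by rw [h]; exact norm_add_le _ _
      _ = (1 - r) + r * (‖x‖ * ‖x‖) := by
        rw [norm_smul, norm_smul, CStarRing.norm_self_mul_star, norm_one, mul_one]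
        congr 2
        · rw [← Complex.ofReal_one, ← Complex.ofReal_sub, Complex.norm_real,
            Real.norm_of_nonneg (by linarith)]
        · rw [Complex.norm_real, Real.norm_of_nonneg h0.le]
  have h3 : ‖x‖ * ‖x‖ ≤ 1 := by nlinarith
  nlinarith [norm_nonneg x]

variable (p q : Set.Ioo (0 : ℝ) 1)

/-- Every element of `O(S³_pq)` is uniformly bounded in all bounded `*`-representations. -/
theorem SpherePoly.exists_bound (x : SpherePoly p q) :
    ∃ C : ℝ, ∀ π : SphereRep p q, ‖π.rep x‖ ≤ C := by
  obtain ⟨x, rfl⟩ := UniversalStarAlgebra.mk_surjective _ x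
  have key : ∀ (y : SphereGen) (π : SphereRep p q),
      ‖π.rep (UniversalStarAlgebra.mk (SphereRel p q) (FreeStarAlgebra.gen y))‖ ≤ 1 := by
    rintro (_ | _) π
    · refine norm_le_one_of_disc q.2.1 q.2.2 ?_
      have h := congrArg π.rep
        (UniversalStarAlgebra.mk_eq (SphereRel p q) (SphereRel.disc_a (p := p) (q := q)))
      simpa only [map_sub, map_mul, map_smul, map_one, ← UniversalStarAlgebra.star_mk,
        map_star] using h
    · refine norm_le_one_of_disc p.2.1 p.2.2 ?_
      have h := congrArg π.rep
        (UniversalStarAlgebra.mk_eq (SphereRel p q) (SphereRel.disc_b (p := p) (q := q)))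
      simpa only [map_sub, map_mul, map_smul, map_one, ← UniversalStarAlgebra.star_mk,
        map_star] using h
  induction x using FreeStarAlgebra.induction with
  | scalar r =>
    refine ⟨‖r‖, fun π => ?_⟩
    rw [AlgHom.commutes, AlgHomClass.commutes, norm_algebraMap, norm_one, mul_one]
  | letter y =>
    refine ⟨1, fun π => ?_⟩
    cases y with
    | inl y => exact key y π
    | inr y =>
      have h : FreeStarAlgebra.letter (Sum.inr y) = star (FreeStarAlgebra.gen y) :=
        (FreeStarAlgebra.star_letter (Sum.inl y)).symm
      rw [h, ← UniversalStarAlgebra.star_mk, map_star, norm_star]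
      exact key y π
  | mul a b ha hb =>
    obtain ⟨C, hC⟩ := ha
    obtain ⟨D, hD⟩ := hb
    refine ⟨C * D, fun π => ?_⟩
    rw [map_mul, map_mul]
    exact (norm_mul_le _ _).trans
      (mul_le_mul (hC π) (hD π) (norm_nonneg _) ((norm_nonneg _).trans (hC π)))
  | add a b ha hb =>
    obtain ⟨C, hC⟩ := ha
    obtain ⟨D, hD⟩ := hb
    refine ⟨C + D, fun π => ?_⟩
    rw [map_add, map_add]
    exact (norm_add_le _ _).trans (add_le_add (hC π) (hD π))

/-- The `ℓ^∞`-product of the operator algebras of all bounded `*`-representations of `O(S³_pq)`. -/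
abbrev SphereProd : Type 1 := lp (fun π : SphereRep p q => π.H →L[ℂ] π.H) ∞

instance : CStarAlgebra (SphereProd p q) where

/-- The direct sum of all bounded `*`-representations of `O(S³_pq)`. The norm of the image of `x`
is the supremum of `‖π x‖` over all bounded `*`-representations `π`. -/
def SpherePoly.univRep : SpherePoly p q →⋆ₐ[ℂ] SphereProd p q where
  toFun x := ⟨fun π => π.rep x, by
    obtain ⟨C, hC⟩ := SpherePoly.exists_bound p q x
    exact memℓp_infty ⟨C, by rintro _ ⟨π, rfl⟩; exact hC π⟩⟩
  map_one' := Subtype.ext (funext fun π => map_one π.rep)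
  map_mul' x y := Subtype.ext (funext fun π => map_mul π.rep x y)
  map_zero' := Subtype.ext (funext fun π => map_zero π.rep)
  map_add' x y := Subtype.ext (funext fun π => map_add π.rep x y)
  commutes' c := Subtype.ext (funext fun π => AlgHomClass.commutes π.rep c)
  map_star' x := Subtype.ext (funext fun π => map_star π.rep x)

theorem SpherePoly.norm_univRep (x : SpherePoly p q) :
    ‖SpherePoly.univRep p q x‖ = ⨆ π : SphereRep p q, ‖π.rep x‖ :=
  lp.norm_eq_ciSup _

/-- The enveloping `C*`-algebra `C(S³_pq)` of `O(S³_pq)`: the (Hausdorff) completion of `O(S³_pq)`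
for the supremum norm over all bounded `*`-representations, realized as the norm closure
of the image of `O(S³_pq)` in the direct sum of all these representations. -/
abbrev SphereCStar : StarSubalgebra ℂ (SphereProd p q) :=
  (SpherePoly.univRep p q).range.topologicalClosure

instance : CStarAlgebra (SphereCStar p q) :=
  StarSubalgebra.cstarAlgebra _ (h_closed := StarSubalgebra.isClosed_topologicalClosure _)

/-- The canonical map `O(S³_pq) → C(S³_pq)`. -/
def SphereCStar.of (x : SpherePoly p q) : SphereCStar p q :=
  ⟨SpherePoly.univRep p q x, StarSubalgebra.le_topologicalClosure _ ⟨x, rfl⟩⟩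

/-- The generators `a`, `b` of `C(S³_pq)`. -/
def SphereCStar.gen (x : SphereGen) : SphereCStar p q :=
  SphereCStar.of p q (UniversalStarAlgebra.gen _ x)

end Sphere

section Toeplitz

/-- The unilateral shift on `ℓ²(ℕ)` as a linear isometry: `(x₀, x₁, …) ↦ (0, x₀, x₁, …)`. -/
def shiftIsometry : ℓ²(ℕ, ℂ) →ₗᵢ[ℂ] ℓ²(ℕ, ℂ) where
  toFun x := ⟨fun n => Nat.casesOn n 0 x, by
    refine memℓp_gen ((summable_nat_add_iff 1).1 ?_)
    exact (lp.memℓp x).summable (by norm_num)⟩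
  map_add' x y := by
    ext n
    cases n
    · exact (add_zero (0 : ℂ)).symm
    · rfl
  map_smul' c x := by
    ext n
    cases n
    · exact (smul_zero c).symm
    · rfl
  norm_map' x := by
    have h2 : 0 < (2 : ℝ≥0∞).toReal := by norm_num
    rw [lp.norm_eq_tsum_rpow h2, lp.norm_eq_tsum_rpow h2]
    congr 1
    rw [Summable.tsum_eq_zero_add]
    · simp
    · refine (summable_nat_add_iff 1).1 ?_
      exact (lp.memℓp x).summable h2

/-- The unilateral shift `s` on `ℓ²(ℕ)`, with `s e_k = e_{k+1}`. -/
def shift : ℓ²(ℕ, ℂ) →L[ℂ] ℓ²(ℕ, ℂ) := shiftIsometry.toContinuousLinearMap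

theorem shift_single (k : ℕ) : shift (lp.single 2 k 1) = lp.single 2 (k + 1) (1 : ℂ) := by
  ext n
  change (Nat.casesOn n 0 (lp.single 2 k (1 : ℂ) : ℕ → ℂ) : ℂ) = _
  cases n with
  | zero => simp
  | succ n => simp [Pi.single_apply]

/-- The Toeplitz algebra: the `C*`-algebra generated by the unilateral shift. -/
abbrev Toeplitz : StarSubalgebra ℂ (ℓ²(ℕ, ℂ) →L[ℂ] ℓ²(ℕ, ℂ)) := StarAlgebra.elemental ℂ shift

/-- The unilateral shift as an element of the Toeplitz algebra. -/
def Toeplitz.s : Toeplitz := ⟨shift, StarAlgebra.elemental.self_mem ℂ shift⟩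

end Toeplitz

section Tensor

open UniformSpace

variable {H K : Type*} [NormedAddCommGroup H] [InnerProductSpace ℂ H]
  [NormedAddCommGroup K] [InnerProductSpace ℂ K]

variable (H K) in
/-- The Hilbert space tensor product: the completion of the algebraic tensor product with respect to
the inner product `⟪x ⊗ y, x' ⊗ y'⟫ = ⟪x, x'⟫ ⟪y, y'⟫`. -/
def HilbertTensor : Type _ := Completion (H ⊗[ℂ] K)

instance : NormedAddCommGroup (HilbertTensor H K) :=
  inferInstanceAs (NormedAddCommGroup (Completion (H ⊗[ℂ] K)))

instance : InnerProductSpace ℂ (HilbertTensor H K) :=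
  inferInstanceAs (InnerProductSpace ℂ (Completion (H ⊗[ℂ] K)))

instance : CompleteSpace (HilbertTensor H K) :=
  inferInstanceAs (CompleteSpace (Completion (H ⊗[ℂ] K)))

/-- The embedding of the algebraic tensor product. -/
def HilbertTensor.incl : H ⊗[ℂ] K →ₗᵢ[ℂ] HilbertTensor H K := Completion.toComplₗᵢ

theorem HilbertTensor.denseRange_incl : DenseRange (HilbertTensor.incl (H := H) (K := K)) :=
  Completion.denseRange_coe

/-- The operator `S ⊗ T` on the Hilbert space tensor product. -/
def opTensor (S : H →L[ℂ] H) (T : K →L[ℂ] K) : HilbertTensor H K →L[ℂ] HilbertTensor H K :=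
  ContinuousLinearMap.completion (TensorProduct.mapL S T)

theorem opTensor_incl (S : H →L[ℂ] H) (T : K →L[ℂ] K) (x : H ⊗[ℂ] K) :
    opTensor S T (HilbertTensor.incl x) = HilbertTensor.incl (TensorProduct.mapL S T x) :=
  ContinuousLinearMap.completion_apply_coe (TensorProduct.mapL S T) x

theorem opTensor_ext {P Q : HilbertTensor H K →L[ℂ] HilbertTensor H K}
    (h : ∀ x, P (HilbertTensor.incl x) = Q (HilbertTensor.incl x)) : P = Q :=
  ContinuousLinearMap.coeFn_injective
    (HilbertTensor.denseRange_incl.equalizer P.continuous Q.continuous (funext h))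

theorem opTensor_mul (S S' : H →L[ℂ] H) (T T' : K →L[ℂ] K) :
    opTensor S T * opTensor S' T' = opTensor (S * S') (T * T') := by
  refine opTensor_ext fun x => ?_
  change opTensor S T (opTensor S' T' _) = _
  rw [opTensor_incl, opTensor_incl, opTensor_incl, TensorProduct.mapL_mul]
  rfl

theorem opTensor_one : opTensor (1 : H →L[ℂ] H) (1 : K →L[ℂ] K) = 1 := by
  refine opTensor_ext fun x => ?_
  rw [opTensor_incl]
  exact congrArg _ (congrArg (fun f : H ⊗[ℂ] K →L[ℂ] H ⊗[ℂ] K => f x) TensorProduct.mapL_id_id)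

theorem star_opTensor [CompleteSpace H] [CompleteSpace K] (S : H →L[ℂ] H) (T : K →L[ℂ] K) :
    star (opTensor S T) = opTensor (star S) (star T) := by
  symm
  refine (ContinuousLinearMap.eq_adjoint_iff _ _).2 fun x y => ?_
  refine HilbertTensor.denseRange_incl.induction_on₂
    (p := fun x y => inner ℂ (opTensor (star S) (star T) x) y = inner ℂ x (opTensor S T y))
    (isClosed_eq (by fun_prop) (by fun_prop)) (fun x y => ?_) x y
  rw [opTensor_incl, opTensor_incl, LinearIsometry.inner_map_map, LinearIsometry.inner_map_map]
  induction x using TensorProduct.induction_on with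
  | zero => simp
  | add x x' hx hx' => rw [map_add, inner_add_left, inner_add_left, hx, hx']
  | tmul u v =>
    induction y using TensorProduct.induction_on with
    | zero => simp
    | add y y' hy hy' => rw [map_add, inner_add_right, inner_add_right, hy, hy']
    | tmul u' v' =>
      rw [TensorProduct.mapL_tmul, TensorProduct.mapL_tmul, TensorProduct.inner_tmul,
        TensorProduct.inner_tmul, ContinuousLinearMap.star_eq_adjoint,
        ContinuousLinearMap.star_eq_adjoint, ContinuousLinearMap.adjoint_inner_left,
        ContinuousLinearMap.adjoint_inner_left]

/-- The spatial (minimal) tensor product of two concrete `C*`-algebras: the closed `*`-algebra of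
operators on the Hilbert space tensor product generated by the operators `S ⊗ T`, where `S` and `T`
range over the two algebras. -/
def spatialTensor [CompleteSpace H] [CompleteSpace K] (A : StarSubalgebra ℂ (H →L[ℂ] H))
    (B : StarSubalgebra ℂ (K →L[ℂ] K)) :
    StarSubalgebra ℂ (HilbertTensor H K →L[ℂ] HilbertTensor H K) :=
  (StarAlgebra.adjoin ℂ {R | ∃ S ∈ A, ∃ T ∈ B, R = opTensor S T}).topologicalClosure

theorem isClosed_spatialTensor [CompleteSpace H] [CompleteSpace K]
    (A : StarSubalgebra ℂ (H →L[ℂ] H)) (B : StarSubalgebra ℂ (K →L[ℂ] K)) :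
    IsClosed (spatialTensor A B : Set (HilbertTensor H K →L[ℂ] HilbertTensor H K)) :=
  StarSubalgebra.isClosed_topologicalClosure _

variable (H K) in
/-- The spatial tensor product of the algebras of compact operators on `H` and `K`: the closed
linear span of the operators `k ⊗ l` with `k`, `l` compact. -/
def compactTensor : Submodule ℂ (HilbertTensor H K →L[ℂ] HilbertTensor H K) :=
  (Submodule.span ℂ {R | ∃ k : H →L[ℂ] H, ∃ l : K →L[ℂ] K,
    IsCompactOperator k ∧ IsCompactOperator l ∧ R = opTensor k l}).topologicalClosure

theorem isClosed_compactTensor :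
    IsClosed (compactTensor H K : Set (HilbertTensor H K →L[ℂ] HilbertTensor H K)) :=
  Submodule.isClosed_topologicalClosure _

theorem compactTensor_induction {p : (HilbertTensor H K →L[ℂ] HilbertTensor H K) → Prop}
    (hp : IsClosed {P | p P}) (zero : p 0) (add : ∀ P Q, p P → p Q → p (P + Q))
    (smul : ∀ (c : ℂ) P, p P → p (c • P))
    (tmul : ∀ (k : H →L[ℂ] H) (l : K →L[ℂ] K), IsCompactOperator k → IsCompactOperator l →
      p (opTensor k l))
    (P : HilbertTensor H K →L[ℂ] HilbertTensor H K) (hP : P ∈ compactTensor H K) : p P := by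
  refine closure_minimal (t := {P | p P}) (fun Q hQ => ?_) hp hP
  refine Submodule.span_induction ?_ zero (fun x y _ _ => add x y) (fun c x _ => smul c x) hQ
  rintro _ ⟨k, l, hk, hl, rfl⟩
  exact tmul k l hk hl

theorem opTensor_mem_compactTensor {k : H →L[ℂ] H} {l : K →L[ℂ] K} (hk : IsCompactOperator k)
    (hl : IsCompactOperator l) : opTensor k l ∈ compactTensor H K :=
  subset_closure (Submodule.subset_span ⟨k, l, hk, hl, rfl⟩)

end Tensor

section Quotient

variable {A : Type*} [CStarAlgebra A] (I : Ideal A) [hI : IsClosed (I : Set A)]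

/-- Approximate units: a closed self-adjoint two-sided ideal contains, for every element `j` and
`ε > 0`, an element `e` with `‖1 - e‖ ≤ 1` and `‖j (1 - e)‖ < ε`. -/
theorem exists_approx_unit (hs : ∀ x ∈ I, star x ∈ I) {j : A} (hj : j ∈ I) {ε : ℝ} (hε : 0 < ε) :
    ∃ e ∈ I, ‖1 - e‖ ≤ 1 ∧ ‖j * (1 - e)‖ < ε := by
  let J : NonUnitalStarSubalgebra ℂ A :=
    { carrier := I
      add_mem' := fun h h' => I.add_mem h h'
      zero_mem' := I.zero_mem
      mul_mem' := fun _ h => I.mul_mem_left _ h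
      smul_mem' := fun c x h => by rw [Algebra.smul_def]; exact I.mul_mem_left _ h
      star_mem' := fun h => hs _ h }
  have : IsClosed (J : Set A) := hI
  let _ : PartialOrder A := CStarAlgebra.spectralOrder A
  have : StarOrderedRing A := CStarAlgebra.spectralOrderedRing A
  let _ : PartialOrder J := CStarAlgebra.spectralOrder J
  have : StarOrderedRing J := CStarAlgebra.spectralOrderedRing J
  have hu := CStarAlgebra.increasingApproximateUnit (A := J)
  have ht := hu.tendsto_mul_left ⟨j, hj⟩
  have := hu.neBot
  obtain ⟨e, h1, h2, h3⟩ := ((Metric.tendsto_nhds.1 ht ε hε).and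
    (hu.eventually_nonneg.and hu.eventually_norm)).exists
  refine ⟨e, e.2, ?_, ?_⟩
  · have he0 : (0 : A) ≤ (e : A) := by
      obtain ⟨y, hy⟩ := CStarAlgebra.nonneg_iff_eq_star_mul_self.1 h2
      rw [hy]
      exact star_mul_self_nonneg (y : A)
    have he1 : (e : A) ≤ 1 := CStarAlgebra.norm_le_one_iff_of_nonneg _ he0 |>.1 h3
    exact (CStarAlgebra.norm_le_one_iff_of_nonneg _ (sub_nonneg.2 he1)).2
      (sub_le_self _ he0)
  · rw [dist_comm, dist_eq_norm] at h1
    rw [mul_sub, mul_one]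
    exact h1

/-- The quotient of a `C*`-algebra by a closed self-adjoint two-sided ideal, with the quotient norm
`‖x + I‖ = inf {‖x + j‖ | j ∈ I}` and the induced involution. -/
@[reducible] def quotientCStarAlgebra [I.IsTwoSided] (hs : ∀ x ∈ I, star x ∈ I) : CStarAlgebra (A ⧸ I) :=
  letI nr : NormedRing (A ⧸ I) :=
    { Submodule.Quotient.normedAddCommGroup I, Ideal.Quotient.ring I with
      norm_mul_le := fun x y => by
        refine le_of_forall_pos_le_add fun ε hε => ?_
        have := ((Metric.nhds_basis_ball.prod_nhds Metric.nhds_basis_ball).tendsto_iff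
          Metric.nhds_basis_ball).mp (continuous_mul.tendsto (‖x‖, ‖y‖)) ε hε
        simp only [Set.mem_prod, Metric.mem_ball, and_imp, Prod.forall, Prod.exists] at this
        rcases this with ⟨ε₁, ε₂, ⟨h₁, h₂⟩, h⟩
        obtain ⟨a, rfl, ha⟩ := Submodule.Quotient.norm_mk_lt x h₁
        obtain ⟨b, rfl, hb⟩ := Submodule.Quotient.norm_mk_lt y h₂
        have ha' : ‖(Submodule.Quotient.mk a : A ⧸ I)‖ ≤ ‖a‖ := Submodule.Quotient.norm_mk_le I a
        have hb' : ‖(Submodule.Quotient.mk b : A ⧸ I)‖ ≤ ‖b‖ := Submodule.Quotient.norm_mk_le I b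
        simp only [dist, abs_sub_lt_iff] at h
        specialize h ‖a‖ ‖b‖ ⟨by linarith, by linarith⟩ ⟨by linarith, by linarith⟩
        calc
          _ ≤ ‖a‖ * ‖b‖ := (Submodule.Quotient.norm_mk_le I (a * b)).trans (norm_mul_le a b)
          _ ≤ _ := (sub_lt_iff_lt_add'.mp h.1).le }
  letI sr : StarRing (A ⧸ I) :=
    { star := Quotient.map' star fun x y h => by
        rw [Submodule.quotientRel_def] at h ⊢
        rw [← star_sub]
        exact hs _ h
      star_involutive := by rintro ⟨x⟩; exact congrArg (Ideal.Quotient.mk I) (star_star x)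
      star_mul := by rintro ⟨x⟩ ⟨y⟩; exact congrArg (Ideal.Quotient.mk I) (star_mul x y)
      star_add := by rintro ⟨x⟩ ⟨y⟩; exact congrArg (Ideal.Quotient.mk I) (star_add x y) }
  { nr, sr, (Ideal.Quotient.algebra ℂ : Algebra ℂ (A ⧸ I)) with
    complete := (Submodule.Quotient.completeSpace I).complete
    norm_smul_le := (Submodule.Quotient.normedSpace I ℂ).norm_smul_le
    star_smul := by rintro c ⟨x⟩; exact congrArg (Ideal.Quotient.mk I) (star_smul c x)
    norm_mul_self_le := by
      rintro ⟨x⟩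
      change ‖(Submodule.Quotient.mk x : A ⧸ I)‖ * ‖(Submodule.Quotient.mk x : A ⧸ I)‖ ≤
        ‖(Submodule.Quotient.mk (star x * x) : A ⧸ I)‖
      refine le_of_forall_pos_le_add fun ε hε => ?_
      obtain ⟨y, hy, hyn⟩ := Submodule.Quotient.norm_mk_lt
        (Submodule.Quotient.mk (star x * x) : A ⧸ I) (half_pos hε)
      have hj : star x * x - y ∈ I := (Submodule.Quotient.eq I).1 hy.symm
      obtain ⟨e, he, he1, hje⟩ := exists_approx_unit I hs hj (half_pos hε)
      have hx : (Submodule.Quotient.mk x : A ⧸ I) = Submodule.Quotient.mk (x * (1 - e)) := by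
        rw [Submodule.Quotient.eq, mul_sub, mul_one, sub_sub_cancel]
        exact I.mul_mem_left _ he
      have hn : ‖(Submodule.Quotient.mk x : A ⧸ I)‖ ≤ ‖x * (1 - e)‖ := by
        rw [hx]; exact Submodule.Quotient.norm_mk_le I _
      have hs1 : ‖star (1 - e)‖ ≤ 1 := by rwa [norm_star]
      calc _ ≤ ‖x * (1 - e)‖ * ‖x * (1 - e)‖ :=
            mul_self_le_mul_self (norm_nonneg _) hn
        _ = ‖star (1 - e) * (y * (1 - e)) + star (1 - e) * ((star x * x - y) * (1 - e))‖ := by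
            rw [← CStarRing.norm_star_mul_self, star_mul]
            congr 1
            noncomm_ring
        _ ≤ ‖star (1 - e)‖ * (‖y‖ * ‖1 - e‖) +
              ‖star (1 - e)‖ * ‖(star x * x - y) * (1 - e)‖ :=
            (norm_add_le _ _).trans (add_le_add ((norm_mul_le _ _).trans
              (mul_le_mul_of_nonneg_left (norm_mul_le _ _) (norm_nonneg _))) (norm_mul_le _ _))
        _ ≤ 1 * (‖y‖ * 1) + 1 * (ε / 2) := by gcongr
        _ ≤ _ := by linarith }

end Quotient

section Ideal

variable {H K : Type*} [NormedAddCommGroup H] [InnerProductSpace ℂ H] [CompleteSpace H]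
  [NormedAddCommGroup K] [InnerProductSpace ℂ K] [CompleteSpace K]

/-- The adjoint of a compact operator on a Hilbert space is compact. -/
theorem isCompactOperator_star {k : H →L[ℂ] H} (hk : IsCompactOperator k) :
    IsCompactOperator (star k : H →L[ℂ] H) := by
  have hg : IsCompactOperator (k * star k : H →L[ℂ] H) := hk.comp_clm (star k)
  have hgt : TotallyBounded ((k * star k : H →L[ℂ] H) '' Metric.closedBall 0 1) :=
    (IsCompactOperator.isCompact_closure_image_closedBall
      (f := ((k * star k : H →L[ℂ] H) : H →ₗ[ℂ] H)) hg 1).totallyBounded.subset subset_closure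
  refine (isCompactOperator_iff_isCompact_closure_image_closedBall
    ((star k : H →L[ℂ] H) : H →ₗ[ℂ] H) one_pos).2
    (TotallyBounded.isCompact_of_isClosed ?_ isClosed_closure)
  refine TotallyBounded.closure (Metric.totallyBounded_iff.2 fun ε hε => ?_)
  have hδ : 0 < ε ^ 2 / 2 := by positivity
  obtain ⟨t, ht, htf, htc⟩ := Metric.finite_approx_of_totallyBounded hgt _ hδ
  choose! u hu hut using fun y (hy : y ∈ t) => ht hy
  refine ⟨(fun y => star k (u y)) '' t, htf.image _, ?_⟩
  rintro _ ⟨x, hx, rfl⟩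
  obtain ⟨y, hy, hxy⟩ := Set.mem_iUnion₂.1 (htc ⟨x, hx, rfl⟩)
  refine Set.mem_iUnion₂.2 ⟨star k (u y), ⟨y, hy, rfl⟩, ?_⟩
  have hx1 : ‖x‖ ≤ 1 := by simpa using hx
  have hu1 : ‖u y‖ ≤ 1 := by simpa using hu y hy
  have h2 : ‖x - u y‖ ≤ 2 := (norm_sub_le _ _).trans (by linarith)
  have h3 : ‖k (star k (x - u y))‖ < ε ^ 2 / 2 := by
    rw [Metric.mem_ball, ← hut y hy, dist_eq_norm] at hxy
    rw [map_sub, map_sub]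
    exact hxy
  have h4 : ‖star k (x - u y)‖ ^ 2 < ε ^ 2 := by
    have h5 : ‖star k (x - u y)‖ ^ 2 ≤ ‖k (star k (x - u y))‖ * ‖x - u y‖ := by
      have h6 := inner_self_eq_norm_sq_to_K (𝕜 := ℂ) (star k (x - u y))
      have h7 := norm_inner_le_norm (𝕜 := ℂ) (k (star k (x - u y))) (x - u y)
      rw [ContinuousLinearMap.star_eq_adjoint] at h6 h7 ⊢
      rw [ContinuousLinearMap.adjoint_inner_right] at h6
      rw [h6, norm_pow, RCLike.norm_ofReal, abs_norm] at h7
      exact h7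
    nlinarith [norm_nonneg (k (star k (x - u y))), norm_nonneg (x - u y)]
  rw [Metric.mem_ball, dist_eq_norm]
  change ‖star k x - star k (u y)‖ < ε
  rw [← map_sub]
  exact lt_of_pow_lt_pow_left₀ 2 hε.le h4


theorem mul_mem_compactTensor {A : StarSubalgebra ℂ (H →L[ℂ] H)} {B : StarSubalgebra ℂ (K →L[ℂ] K)}
    {R P : HilbertTensor H K →L[ℂ] HilbertTensor H K} (hR : R ∈ spatialTensor A B)
    (hP : P ∈ compactTensor H K) : R * P ∈ compactTensor H K ∧ P * R ∈ compactTensor H K := by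
  have hc := isClosed_compactTensor (H := H) (K := K)
  suffices h : ∀ P, P ∈ compactTensor H K →
      R * P ∈ compactTensor H K ∧ P * R ∈ compactTensor H K from h P hP
  refine closure_minimal (t := {R | ∀ P, P ∈ compactTensor H K →
    R * P ∈ compactTensor H K ∧ P * R ∈ compactTensor H K}) (fun R hR => ?_) ?_ hR
  · have key : ∀ (S : H →L[ℂ] H) (T : K →L[ℂ] K), ∀ P, P ∈ compactTensor H K →
        opTensor S T * P ∈ compactTensor H K ∧ P * opTensor S T ∈ compactTensor H K := by
      intro S T P hP
      refine compactTensor_induction (p := fun P => opTensor S T * P ∈ compactTensor H K ∧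
        P * opTensor S T ∈ compactTensor H K) ?_ ?_ ?_ ?_ ?_ P hP
      · exact (hc.preimage (continuous_const_mul _)).inter (hc.preimage (continuous_mul_const _))
      · simp
      · intro P Q hP hQ
        rw [mul_add, add_mul]
        exact ⟨add_mem hP.1 hQ.1, add_mem hP.2 hQ.2⟩
      · intro c P hP
        rw [mul_smul_comm, smul_mul_assoc]
        exact ⟨Submodule.smul_mem _ _ hP.1, Submodule.smul_mem _ _ hP.2⟩
      · intro k l hk hl
        rw [opTensor_mul, opTensor_mul]
        exact ⟨opTensor_mem_compactTensor (hk.clm_comp S) (hl.clm_comp T),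
          opTensor_mem_compactTensor (hk.comp_clm S) (hl.comp_clm T)⟩
    replace hR : R ∈ Algebra.adjoin ℂ ({R | ∃ S ∈ A, ∃ T ∈ B, R = opTensor S T} ∪
      star {R | ∃ S ∈ A, ∃ T ∈ B, R = opTensor S T}) := hR
    induction hR using Algebra.adjoin_induction with
    | mem R h =>
      rcases h with ⟨S, -, T, -, rfl⟩ | ⟨S, -, T, -, h⟩
      · exact key S T
      · rw [← star_star R, h, star_opTensor]
        exact key _ _
    | algebraMap c =>
      intro P hP
      rw [← Algebra.smul_def, ← Algebra.commutes, ← Algebra.smul_def]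
      exact ⟨Submodule.smul_mem _ _ hP, Submodule.smul_mem _ _ hP⟩
    | add R R' _ _ h h' =>
      intro P hP
      rw [add_mul, mul_add]
      exact ⟨add_mem (h P hP).1 (h' P hP).1, add_mem (h P hP).2 (h' P hP).2⟩
    | mul R R' _ _ h h' =>
      intro P hP
      rw [mul_assoc, ← mul_assoc P]
      exact ⟨(h _ (h' P hP).1).1, (h' _ (h P hP).2).2⟩
  · simp only [Set.ofPred_forall]
    exact isClosed_iInter fun P => isClosed_iInter fun _ =>
      (hc.preimage (continuous_mul_const P)).inter (hc.preimage (continuous_const_mul P))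

theorem star_mem_compactTensor {P : HilbertTensor H K →L[ℂ] HilbertTensor H K}
    (hP : P ∈ compactTensor H K) : star P ∈ compactTensor H K := by
  refine compactTensor_induction (p := fun P => star P ∈ compactTensor H K) ?_ ?_ ?_ ?_ ?_ P hP
  · exact isClosed_compactTensor.preimage continuous_star
  · simp
  · intro P Q hP hQ
    rw [star_add]
    exact add_mem hP hQ
  · intro c P hP
    rw [star_smul]
    exact Submodule.smul_mem _ _ hP
  · intro k l hk hl
    rw [star_opTensor]
    exact opTensor_mem_compactTensor (isCompactOperator_star hk) (isCompactOperator_star hl)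

end Ideal

section CompactIdeal

variable {H K : Type*} [NormedAddCommGroup H] [InnerProductSpace ℂ H] [CompleteSpace H]
  [NormedAddCommGroup K] [InnerProductSpace ℂ K] [CompleteSpace K]
  (A : StarSubalgebra ℂ (H →L[ℂ] H)) (B : StarSubalgebra ℂ (K →L[ℂ] K))

instance : CStarAlgebra (spatialTensor A B) :=
  StarSubalgebra.cstarAlgebra _ (h_closed := isClosed_spatialTensor A B)

/-- The operators in `K(H) ⊗ K(K)` which belong to `A ⊗ B`, as an ideal of `A ⊗ B`. -/
def compactIdeal : Ideal (spatialTensor A B) where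
  carrier := {x | x.1 ∈ compactTensor H K}
  add_mem' {x y} hx hy := (compactTensor H K).add_mem (x := x.1) (y := y.1) hx hy
  zero_mem' := (compactTensor H K).zero_mem
  smul_mem' r x hx := (mul_mem_compactTensor (R := r.1) (P := x.1) r.2 hx).1

theorem mem_compactIdeal {x : spatialTensor A B} :
    x ∈ compactIdeal A B ↔ x.1 ∈ compactTensor H K := Iff.rfl

instance : (compactIdeal A B).IsTwoSided where
  mul_mem_of_left {x} r hx := (mul_mem_compactTensor (R := r.1) (P := x.1) r.2 hx).2

instance : IsClosed (compactIdeal A B : Set (spatialTensor A B)) :=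
  (isClosed_compactTensor (H := H) (K := K)).preimage continuous_subtype_val

theorem star_mem_compactIdeal (x : spatialTensor A B) (hx : x ∈ compactIdeal A B) :
    star x ∈ compactIdeal A B :=
  star_mem_compactTensor (P := x.1) hx

end CompactIdeal

section ToeplitzQuotient

/-- The tensor product `T ⊗ T` of the Toeplitz algebra with itself, acting on `ℓ²(ℕ) ⊗ ℓ²(ℕ)`.
(As `T` is nuclear, there is only one `C*`-tensor product.) -/
abbrev ToeplitzTensor :
    StarSubalgebra ℂ (HilbertTensor ℓ²(ℕ, ℂ) ℓ²(ℕ, ℂ) →L[ℂ] HilbertTensor ℓ²(ℕ, ℂ) ℓ²(ℕ, ℂ)) :=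
  spatialTensor Toeplitz Toeplitz

/-- The elementary tensor `x ⊗ y` in `T ⊗ T`. -/
def Toeplitz.tmul (x y : Toeplitz) : ToeplitzTensor :=
  ⟨opTensor x y, StarSubalgebra.le_topologicalClosure _
    (StarAlgebra.subset_adjoin ℂ _ ⟨x, x.2, y, y.2, rfl⟩)⟩

/-- The quotient `(T ⊗ T) / (K ⊗ K)`, where `K` is the algebra of compact operators on `ℓ²(ℕ)`.
(Every compact operator belongs to `T`, so that `K ⊗ K` is contained in `T ⊗ T`.) -/
def ToeplitzQuotient : Type := ToeplitzTensor ⧸ compactIdeal Toeplitz Toeplitz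

instance : CStarAlgebra ToeplitzQuotient :=
  quotientCStarAlgebra (compactIdeal Toeplitz Toeplitz) (star_mem_compactIdeal Toeplitz Toeplitz)

/-- The canonical surjection `T ⊗ T → (T ⊗ T) / (K ⊗ K)`. -/
def ToeplitzQuotient.mk : ToeplitzTensor →⋆ₐ[ℂ] ToeplitzQuotient where
  toFun x := Ideal.Quotient.mk (compactIdeal Toeplitz Toeplitz) x
  map_one' := rfl
  map_mul' _ _ := rfl
  map_zero' := rfl
  map_add' _ _ := rfl
  commutes' _ := rfl
  map_star' _ := rfl

end ToeplitzQuotient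

end

/-!
The relations say that `a` and `b` are weighted shifts of doubly commuting isometries with
orthogonal defects. Indeed, a solution of the disc relation `x^* x = (1 - r) + r x x^*` has an
invertible modulus, and if `x = v |x|` is its polar decomposition, then `v` is an isometry
and iteration of `|x|² = (1 - r) + r v |x|² v^*` expands `|x|²` into a series in the decreasing
projections `vⁿ v^*ⁿ`, whose square root is explicit: `x` is the weighted shift `w_r(v)`
(`exists_isometry_of_disc`). Conversely `w_r(v)` satisfies the disc relation, and `v` belongs to
the `C*`-algebra which it generates. As `v` and `x` generate the same `C*`-algebra, the
remaining relations for `a = w_q(V)` and `b = w_p(W)` mean that `V` and `W` doubly commute and that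
`(1 - V V^*) (1 - W W^*) = 0` (`exists_isometries_of_sphere`, `exists_sphere_hom`).

The classes of `s ⊗ 1` and `1 ⊗ s` modulo `K ⊗ K` are such a pair, whence a homomorphism `Φ` from
`O(S³_pq)` to the quotient. Its range is dense because `s` is recovered from `w_r`, and it remains
to compare `‖Φ x‖` with the supremum of the norms `‖ρ x‖` over all representations `ρ`.

* The GNS construction represents the quotient on a Hilbert space without decreasing the norm of a
  prescribed element, so that `‖Φ x‖` is at most the supremum (`norm_le_norm_univRep`).
* Let `ρ` be given by a pair `V`, `W` on `H`. Instead of a Wold decomposition, the proof uses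
  isometries `J n : H → H ⊗ (ℓ² ⊗ ℓ²)` which intertwine `V` with `1 ⊗ s ⊗ 1` and `W` with
  `1 ⊗ 1 ⊗ s` up to an error of size `√(3 / n)`. For a single isometry `V` such a map is
  `h ↦ ∑ i < n, windowOp V n i h ⊗ e i`, where `windowOp V n i` is `V^*ⁱ` followed by a weight
  on the defect space and another one on the range of `V`. The weights make the sum of squares
  telescope to `‖h‖²` and vary slowly with `i`; for a pair the two constructions are composed.
  The pairs `(R, X)` for which `(1 ⊗ R) J n - J n X` tends to zero form a closed algebra
  (`asympIntertwiners`), and `‖X‖ ≤ ‖R‖` for such pairs. It contains the value of every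
  `*`-polynomial at the generators. Orthogonality of the defects puts
  `((1 - sⁿ s^*ⁿ) ⊗ (1 - sⁿ s^*ⁿ), 0)` into it, and hence `(R, 0)` for all `R` in `K ⊗ K`. So
  `‖ρ x‖` is at most the norm of the polynomial in the weighted shifts modulo `K ⊗ K`
  (`norm_le_norm_add_compact`), which is `‖Φ x‖`.

Both seminorms on `O(S³_pq)` thus agree, and the isomorphism is the closure of the correspondence
between the images of `x` in the two algebras (`exists_starAlgEquiv_of_norm_eq`).
-/

noncomputable section

open Filter Topology
open scoped ComplexOrder

/-! ### Weighted shifts of isometries and the disc relation -/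

section WeightedShift

/-- The coefficients `√(1 - r^(n+1)) - √(1 - r^n)` of the weighted shift `w_r`. -/
def shiftWeight (r : ℝ) (n : ℕ) : ℝ := √(1 - r ^ (n + 1)) - √(1 - r ^ n)

theorem sum_range_shiftWeight (r : ℝ) (N : ℕ) :
    ∑ n ∈ Finset.range N, shiftWeight r n = √(1 - r ^ N) := by
  simp only [shiftWeight]
  rw [Finset.sum_range_sub (fun n => √(1 - r ^ n))]
  simp

theorem shiftWeight_nonneg {r : ℝ} (h0 : 0 < r) (h1 : r < 1) (n : ℕ) : 0 ≤ shiftWeight r n := by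
  rw [shiftWeight, sub_nonneg]
  refine Real.sqrt_le_sqrt ?_
  have := pow_le_pow_of_le_one h0.le h1.le (Nat.le_succ n)
  simp only [Nat.succ_eq_add_one] at this
  linarith

theorem summable_shiftWeight {r : ℝ} (h0 : 0 < r) (h1 : r < 1) : Summable (shiftWeight r) := by
  refine summable_of_sum_range_le (c := 1) (shiftWeight_nonneg h0 h1) fun N => ?_
  rw [sum_range_shiftWeight]
  exact Real.sqrt_le_one.2 (by linarith [pow_pos h0 N])

/-- The recursion which makes `∑ n < N, c n • P n` a square root of
`∑ n < N, (1 - r) * r ^ n • P n` for decreasing projections `P n`. -/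
theorem shiftWeight_sq {r : ℝ} (h0 : 0 < r) (h1 : r < 1) (N : ℕ) :
    2 * (shiftWeight r N * √(1 - r ^ N)) + shiftWeight r N * shiftWeight r N =
      (1 - r) * r ^ N := by
  have hN : 0 ≤ 1 - r ^ N := by linarith [pow_le_one₀ (n := N) h0.le h1.le]
  have hN1 : 0 ≤ 1 - r ^ (N + 1) := by linarith [pow_le_one₀ (n := N + 1) h0.le h1.le]
  have e := Real.mul_self_sqrt hN
  have e1 := Real.mul_self_sqrt hN1
  rw [shiftWeight]
  rw [pow_succ] at e1 ⊢
  linear_combination e1 - e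

variable {M : Type*} [CStarAlgebra M]

theorem star_pow_mul_pow_self {v : M} (hv : star v * v = 1) (n : ℕ) : star v ^ n * v ^ n = 1 := by
  induction n with
  | zero => simp
  | succ n ih => rw [pow_succ, pow_succ', mul_assoc, ← mul_assoc (star v) v, hv, one_mul, ih]

theorem star_pow_mul_pow_add {v : M} (hv : star v * v = 1) (m n : ℕ) :
    star v ^ m * v ^ (m + n) = v ^ n := by
  rw [pow_add, ← mul_assoc, star_pow_mul_pow_self hv, one_mul]

theorem isSelfAdjoint_pow_mul_star_pow (v : M) (n : ℕ) : IsSelfAdjoint (v ^ n * star v ^ n) := by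
  rw [← star_pow]
  exact .mul_star_self _

theorem norm_le_one_of_isometry {v : M} (hv : star v * v = 1) : ‖v‖ ≤ 1 := by
  rcases subsingleton_or_nontrivial M with h | h
  · rw [Subsingleton.elim v 0, norm_zero]; exact zero_le_one
  · have := CStarRing.norm_star_mul_self (x := v)
    rw [hv, norm_one] at this
    nlinarith [norm_nonneg v]

theorem norm_pow_mul_star_pow_le {v : M} (hv : star v * v = 1) (m n : ℕ) :
    ‖v ^ m * star v ^ n‖ ≤ 1 := by
  have hv1 := norm_le_one_of_isometry hv
  rcases subsingleton_or_nontrivial M with h | h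
  · rw [Subsingleton.elim (v ^ m * star v ^ n) 0, norm_zero]; exact zero_le_one
  · calc ‖v ^ m * star v ^ n‖ ≤ ‖v ^ m‖ * ‖star v ^ n‖ := norm_mul_le _ _
      _ ≤ ‖v‖ ^ m * ‖star v‖ ^ n := by gcongr <;> exact norm_pow_le _ _
      _ ≤ 1 * 1 := by
        rw [norm_star]
        gcongr <;> exact pow_le_one₀ (norm_nonneg v) hv1
      _ = 1 := one_mul 1

/-- Range projections of powers of an isometry decrease. -/
theorem rangeProj_mul_rangeProj {v : M} (hv : star v * v = 1) {m n : ℕ} (h : m ≤ n) :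
    (v ^ m * star v ^ m) * (v ^ n * star v ^ n) = v ^ n * star v ^ n := by
  obtain ⟨k, rfl⟩ := Nat.exists_eq_add_of_le h
  rw [mul_assoc, ← mul_assoc (star v ^ m), star_pow_mul_pow_add hv, ← mul_assoc, ← pow_add]

theorem rangeProj_mul_rangeProj' {v : M} (hv : star v * v = 1) {m n : ℕ} (h : m ≤ n) :
    (v ^ n * star v ^ n) * (v ^ m * star v ^ m) = v ^ n * star v ^ n := by
  have := congrArg star (rangeProj_mul_rangeProj hv h)
  rwa [star_mul, (isSelfAdjoint_pow_mul_star_pow v m).star_eq,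
    (isSelfAdjoint_pow_mul_star_pow v n).star_eq] at this

/-- The positive part of the weighted shift attached to the isometry `v`: the diagonal operator
with entries `√(1 - r^(n+1))` when `v` is the unilateral shift. -/
def weightedShiftAbs (r : ℝ) (v : M) : M :=
  ∑' n : ℕ, (shiftWeight r n : ℂ) • (v ^ n * star v ^ n)

/-- The weighted shift `w_r` attached to the isometry `v`. -/
def weightedShift (r : ℝ) (v : M) : M := v * weightedShiftAbs r v

variable {r : ℝ} (h0 : 0 < r) (h1 : r < 1) {v : M} (hv : star v * v = 1)
include h0 h1 hv

theorem hasSum_weightedShiftAbs :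
    HasSum (fun n : ℕ => (shiftWeight r n : ℂ) • (v ^ n * star v ^ n)) (weightedShiftAbs r v) := by
  refine Summable.hasSum (Summable.of_norm_bounded (summable_shiftWeight h0 h1) fun n => ?_)
  rw [norm_smul, Complex.norm_real, Real.norm_of_nonneg (shiftWeight_nonneg h0 h1 n)]
  exact mul_le_of_le_one_right (shiftWeight_nonneg h0 h1 n) (norm_pow_mul_star_pow_le hv n n)

theorem hasSum_weightedShift :
    HasSum (fun n : ℕ => (shiftWeight r n : ℂ) • (v ^ (n + 1) * star v ^ n))
      (weightedShift r v) := by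
  have := (hasSum_weightedShiftAbs h0 h1 hv).mul_left v
  rw [weightedShift]
  simpa only [mul_smul_comm, ← mul_assoc, ← pow_succ'] using this

theorem hasSum_weightedShiftAbs_sq :
    HasSum (fun n : ℕ => (((1 - r) * r ^ n : ℝ) : ℂ) • (v ^ n * star v ^ n))
      (weightedShiftAbs r v * weightedShiftAbs r v) := by
  have hs : Summable (fun n : ℕ => (((1 - r) * r ^ n : ℝ) : ℂ) • (v ^ n * star v ^ n)) := by
    refine Summable.of_norm_bounded ((summable_geometric_of_lt_one h0.le h1).mul_left (1 - r))
      fun n => ?_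
    have hn : 0 ≤ (1 - r) * r ^ n := mul_nonneg (by linarith) (pow_nonneg h0.le n)
    rw [norm_smul, Complex.norm_real, Real.norm_of_nonneg hn]
    exact mul_le_of_le_one_right hn (norm_pow_mul_star_pow_le hv n n)
  have hL := (hasSum_weightedShiftAbs h0 h1 hv).tendsto_sum_nat
  have key : ∀ N, (∑ n ∈ Finset.range N, (shiftWeight r n : ℂ) • (v ^ n * star v ^ n)) *
      (∑ n ∈ Finset.range N, (shiftWeight r n : ℂ) • (v ^ n * star v ^ n)) =
      ∑ n ∈ Finset.range N, (((1 - r) * r ^ n : ℝ) : ℂ) • (v ^ n * star v ^ n) := by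
    intro N
    induction N with
    | zero => simp
    | succ N ih =>
      have e1 : (∑ n ∈ Finset.range N, (shiftWeight r n : ℂ) • (v ^ n * star v ^ n)) *
          (v ^ N * star v ^ N) = ((√(1 - r ^ N) : ℝ) : ℂ) • (v ^ N * star v ^ N) := by
        rw [← sum_range_shiftWeight, Complex.ofReal_sum, Finset.sum_smul, Finset.sum_mul]
        refine Finset.sum_congr rfl fun n hn => ?_
        rw [smul_mul_assoc, rangeProj_mul_rangeProj hv (Finset.mem_range.1 hn).le]
      have e2 : (v ^ N * star v ^ N) *
          (∑ n ∈ Finset.range N, (shiftWeight r n : ℂ) • (v ^ n * star v ^ n)) =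
          ((√(1 - r ^ N) : ℝ) : ℂ) • (v ^ N * star v ^ N) := by
        rw [← sum_range_shiftWeight, Complex.ofReal_sum, Finset.sum_smul, Finset.mul_sum]
        refine Finset.sum_congr rfl fun n hn => ?_
        rw [mul_smul_comm, rangeProj_mul_rangeProj' hv (Finset.mem_range.1 hn).le]
      rw [Finset.sum_range_succ, Finset.sum_range_succ, add_mul, mul_add, mul_add, ih,
        mul_smul_comm, e1, smul_mul_assoc, e2, smul_mul_smul_comm,
        rangeProj_mul_rangeProj hv le_rfl, smul_smul, add_assoc, ← add_smul, ← add_smul]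
      congr 2
      rw [← shiftWeight_sq h0 h1 N]
      push_cast
      ring
  have := hL.mul hL
  simp only [key] at this
  rw [tendsto_nhds_unique this hs.hasSum.tendsto_sum_nat]
  exact hs.hasSum

theorem isSelfAdjoint_weightedShiftAbs : IsSelfAdjoint (weightedShiftAbs r v) := by
  have h := (hasSum_weightedShiftAbs h0 h1 hv).star
  simp only [star_smul, (isSelfAdjoint_pow_mul_star_pow v _).star_eq, Complex.star_def,
    Complex.conj_ofReal] at h
  exact h.unique (hasSum_weightedShiftAbs h0 h1 hv)

theorem weightedShiftAbs_nonneg [PartialOrder M] [StarOrderedRing M] :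
    0 ≤ weightedShiftAbs r v := by
  refine (hasSum_weightedShiftAbs h0 h1 hv).nonneg fun n => ?_
  rw [← star_pow]
  have : (0 : ℂ) ≤ (shiftWeight r n : ℂ) := by
    exact_mod_cast shiftWeight_nonneg h0 h1 n
  exact smul_nonneg this (mul_star_self_nonneg _)

theorem weightedShift_mul_star :
    weightedShift r v * star (weightedShift r v) =
      v * (weightedShiftAbs r v * weightedShiftAbs r v) * star v := by
  rw [weightedShift, star_mul, (isSelfAdjoint_weightedShiftAbs h0 h1 hv).star_eq]
  noncomm_ring

theorem star_weightedShift_mul :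
    star (weightedShift r v) * weightedShift r v =
      weightedShiftAbs r v * weightedShiftAbs r v := by
  rw [weightedShift, star_mul, (isSelfAdjoint_weightedShiftAbs h0 h1 hv).star_eq, mul_assoc,
    ← mul_assoc (star v), hv, one_mul]

theorem hasSum_weightedShift_mul_star :
    HasSum (fun n : ℕ => (((1 - r) * r ^ n : ℝ) : ℂ) • (v ^ (n + 1) * star v ^ (n + 1)))
      (weightedShift r v * star (weightedShift r v)) := by
  rw [weightedShift_mul_star h0 h1 hv]
  have := ((hasSum_weightedShiftAbs_sq h0 h1 hv).mul_left v).mul_right (star v)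
  refine this.congr_fun fun n => ?_
  rw [mul_smul_comm, smul_mul_assoc, pow_succ', pow_succ (star v)]
  noncomm_ring

/-- The weighted shift attached to an isometry satisfies the disc relation. -/
theorem weightedShift_disc :
    star (weightedShift r v) * weightedShift r v -
      (r : ℂ) • (weightedShift r v * star (weightedShift r v)) = (1 - (r : ℂ)) • 1 := by
  rw [star_weightedShift_mul h0 h1 hv, sub_eq_iff_eq_add]
  refine (hasSum_weightedShiftAbs_sq h0 h1 hv).unique ?_
  have := (hasSum_weightedShift_mul_star h0 h1 hv).const_smul (r : ℂ)
  have := hasSum_nat_add_iff' (f := fun n : ℕ => (((1 - r) * r ^ n : ℝ) : ℂ) •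
    (v ^ n * star v ^ n)) (g := (1 - (r : ℂ)) • 1 +
    (r : ℂ) • (weightedShift r v * star (weightedShift r v))) 1 |>.1
  refine this ?_
  simp only [Finset.range_one, Finset.sum_singleton, pow_zero, mul_one, Complex.ofReal_sub,
    Complex.ofReal_one, add_sub_cancel_left]
  refine ((hasSum_weightedShift_mul_star h0 h1 hv).const_smul (r : ℂ)).congr_fun fun n => ?_
  rw [smul_smul]
  congr 1
  push_cast
  ring

omit hv in
/-- The modulus of a solution of the disc relation is bounded below, hence strictly positive. -/
theorem isStrictlyPositive_of_disc [PartialOrder M] [StarOrderedRing M] {x : M}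
    (hx : star x * x - (r : ℂ) • (x * star x) = (1 - (r : ℂ)) • 1) :
    IsStrictlyPositive (star x * x) := by
  rw [sub_eq_iff_eq_add] at hx
  rw [hx]
  refine IsStrictlyPositive.add_nonneg ?_ ?_
  · have hr : (0 : ℂ) ≤ 1 - (r : ℂ) := by
      rw [sub_nonneg]
      exact_mod_cast h1.le
    have hr' : (1 - (r : ℂ)) ≠ 0 := by
      rw [sub_ne_zero]
      exact_mod_cast h1.ne'
    refine ⟨smul_nonneg hr zero_le_one, ?_⟩
    rw [← Algebra.algebraMap_eq_smul_one]
    exact (IsUnit.mk0 _ hr').map _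
  · have hr : (0 : ℂ) ≤ (r : ℂ) := by exact_mod_cast h0.le
    exact smul_nonneg hr (mul_star_self_nonneg _)

omit h0 h1 hv in
/-- An element bounded below has an inverse modulus in the `C*`-algebra which it generates. -/
theorem exists_inv_abs_mem_elemental [PartialOrder M] [StarOrderedRing M] {x : M}
    (hx : IsStrictlyPositive (star x * x)) :
    ∃ g ∈ StarAlgebra.elemental ℂ x, IsSelfAdjoint g ∧
      CFC.sqrt (star x * x) * g = 1 ∧ g * CFC.sqrt (star x * x) = 1 := by
  refine ⟨(star x * x) ^ (-(1 / 2) : ℝ), ?_, CFC.rpow_nonneg.isSelfAdjoint, ?_, ?_⟩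
  · rw [CFC.rpow_eq_cfc_real]
    have : IsClosed (StarAlgebra.elemental ℂ x : Set M) := StarAlgebra.elemental.isClosed ℂ x
    exact cfc_mem (𝕜' := ℂ) _ (mul_mem (StarAlgebra.elemental.star_self_mem ℂ x)
      (StarAlgebra.elemental.self_mem ℂ x))
  · rw [CFC.sqrt_eq_rpow, CFC.rpow_mul_rpow_neg]
  · rw [CFC.sqrt_eq_rpow, CFC.rpow_neg_mul_rpow]

/-- An isometry is recovered from its weighted shift by polar decomposition. -/
theorem mem_elemental_weightedShift :
    v ∈ StarAlgebra.elemental ℂ (weightedShift r v) := by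
  let _ : PartialOrder M := CStarAlgebra.spectralOrder M
  have : StarOrderedRing M := CStarAlgebra.spectralOrderedRing M
  obtain ⟨g, hg, -, hg1, -⟩ := exists_inv_abs_mem_elemental
    (isStrictlyPositive_of_disc h0 h1 (weightedShift_disc h0 h1 hv))
  have hs : CFC.sqrt (star (weightedShift r v) * weightedShift r v) = weightedShiftAbs r v :=
    CFC.sqrt_unique (star_weightedShift_mul h0 h1 hv).symm (weightedShiftAbs_nonneg h0 h1 hv)
  have hv' : v = weightedShift r v * g := by
    rw [weightedShift, mul_assoc, ← hs, hg1, mul_one]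
  have := mul_mem (StarAlgebra.elemental.self_mem ℂ (weightedShift r v)) hg
  rwa [← hv'] at this

omit hv in
/-- Every solution `x` of the disc relation is the weighted shift of an isometry in the
`C*`-algebra generated by `x`, namely of the isometry in the polar decomposition of `x`. -/
theorem exists_isometry_of_disc {x : M}
    (hx : star x * x - (r : ℂ) • (x * star x) = (1 - (r : ℂ)) • 1) :
    ∃ v ∈ StarAlgebra.elemental ℂ x, star v * v = 1 ∧ weightedShift r v = x := by
  let _ : PartialOrder M := CStarAlgebra.spectralOrder M
  have : StarOrderedRing M := CStarAlgebra.spectralOrderedRing M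
  obtain ⟨g, hg, hgs, hg1, hg2⟩ := exists_inv_abs_mem_elemental
    (isStrictlyPositive_of_disc h0 h1 hx)
  have hL : CFC.sqrt (star x * x) * CFC.sqrt (star x * x) = star x * x :=
    CFC.sqrt_mul_sqrt_self _ (star_mul_self_nonneg x)
  have hLs : IsSelfAdjoint (CFC.sqrt (star x * x)) := (CFC.sqrt_nonneg _).isSelfAdjoint
  set L := CFC.sqrt (star x * x) with hLdef
  have hv : star (x * g) * (x * g) = 1 := by
    rw [star_mul, hgs.star_eq, mul_assoc, ← mul_assoc (star x), ← hL, mul_assoc L, hg1, mul_one,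
      hg2]
  have hxv : x = x * g * L := by rw [mul_assoc, hg2, mul_one]
  refine ⟨x * g, mul_mem (StarAlgebra.elemental.self_mem ℂ x) hg, hv, ?_⟩
  set v := x * g
  have hT : star x * x = (1 - (r : ℂ)) • 1 + (r : ℂ) • (v * (star x * x) * star v) := by
    rw [sub_eq_iff_eq_add] at hx
    have hxx : x * star x = v * (star x * x) * star v := by
      rw [← hL]
      nth_rewrite 1 2 [hxv]
      rw [star_mul, hLs.star_eq]
      noncomm_ring
    rwa [hxx] at hx
  -- Iterating `hT` expands `star x * x` into the series for the square of `weightedShiftAbs r v`.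
  have key : ∀ N, star x * x = ∑ n ∈ Finset.range N,
      (((1 - r) * r ^ n : ℝ) : ℂ) • (v ^ n * star v ^ n) +
      ((r : ℂ) ^ N) • (v ^ N * (star x * x) * star v ^ N) := by
    intro N
    induction N with
    | zero => simp
    | succ N ih =>
      rw [Finset.sum_range_succ, add_assoc]
      refine ih.trans (congrArg _ ?_)
      conv_lhs => rw [hT]
      rw [mul_add, add_mul, smul_add, mul_smul_comm, mul_smul_comm, smul_mul_assoc,
        smul_mul_assoc, mul_one, smul_smul, smul_smul, pow_succ v, pow_succ' (star v)]
      congr 1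
      · congr 1
        push_cast
        ring
      · rw [← pow_succ]
        noncomm_ring
  have hlim : Tendsto (fun N => ((r : ℂ) ^ N) • (v ^ N * (star x * x) * star v ^ N)) atTop
      (𝓝 0) := by
    have h2 : Tendsto (fun N : ℕ => r ^ N * ‖star x * x‖) atTop (𝓝 0) := by
      simpa using (tendsto_pow_atTop_nhds_zero_of_lt_one h0.le h1).mul_const ‖star x * x‖
    refine squeeze_zero_norm (fun N => ?_) h2
    rw [norm_smul, norm_pow, Complex.norm_real, Real.norm_of_nonneg h0.le]
    refine mul_le_mul_of_nonneg_left ?_ (pow_nonneg h0.le N)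
    have hn1 : ‖v ^ N‖ ≤ 1 := by simpa using norm_pow_mul_star_pow_le hv N 0
    have hn2 : ‖star v ^ N‖ ≤ 1 := by simpa using norm_pow_mul_star_pow_le hv 0 N
    calc _ ≤ ‖v ^ N‖ * ‖star x * x‖ * ‖star v ^ N‖ :=
          (norm_mul_le _ _).trans (mul_le_mul_of_nonneg_right (norm_mul_le _ _) (norm_nonneg _))
      _ ≤ 1 * ‖star x * x‖ * 1 := by gcongr
      _ = _ := by ring
  have hsq : weightedShiftAbs r v * weightedShiftAbs r v = star x * x := by
    have h3 := (hasSum_weightedShiftAbs_sq h0 h1 hv).tendsto_sum_nat.add hlim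
    simp only [← key, add_zero] at h3
    exact tendsto_nhds_unique h3 tendsto_const_nhds
  rw [weightedShift, ← CFC.sqrt_unique hsq (weightedShiftAbs_nonneg h0 h1 hv), ← hLdef, ← hxv]

end WeightedShift

/-! ### Doubly commuting isometries and the sphere relations -/

section DoublyCommuting

variable {M : Type*} [CStarAlgebra M] {v w : M}

/-- If the defect projections of two doubly commuting isometries are orthogonal, then so are the
complements of the ranges of their powers. -/
theorem defect_pow_mul_defect_pow (hvw : Commute v w) (hvw' : Commute (star v) w)
    (h : (1 - v * star v) * (1 - w * star w) = 0) (m n : ℕ) :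
    (1 - v ^ m * star v ^ m) * (1 - w ^ n * star w ^ n) = 0 := by
  have tele : ∀ (u : M) (N : ℕ), 1 - u ^ N * star u ^ N =
      ∑ i ∈ Finset.range N, u ^ i * (1 - u * star u) * star u ^ i := by
    intro u N
    induction N with
    | zero => simp
    | succ N ih =>
      rw [Finset.sum_range_succ, ← ih, pow_succ, pow_succ' (star u)]
      noncomm_ring
  rw [tele, tele, Finset.sum_mul_sum]
  refine Finset.sum_eq_zero fun i _ => Finset.sum_eq_zero fun j _ => ?_
  have c1 : Commute (star v) (star w) := by
    have := hvw.star_star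
    exact this
  have c2 : Commute v (star w) := by
    have := hvw'.star_star
    rwa [star_star] at this
  have e1 : Commute (star v ^ i) (w ^ j) := hvw'.pow_pow i j
  have e2 : Commute (star v ^ i) (1 - w * star w) :=
    (Commute.one_right _).sub_right ((hvw'.pow_left i).mul_right (c1.pow_left i))
  have e3 : Commute (1 - v * star v) (w ^ j) :=
    (Commute.one_left _).sub_left ((hvw.pow_right j).mul_left (hvw'.pow_right j))
  calc _ = v ^ i * (1 - v * star v) * (star v ^ i * w ^ j) * (1 - w * star w) * star w ^ j := by
        noncomm_ring
    _ = v ^ i * (1 - v * star v) * w ^ j * (star v ^ i * (1 - w * star w)) * star w ^ j := by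
        rw [e1.eq]; noncomm_ring
    _ = v ^ i * ((1 - v * star v) * w ^ j) * (1 - w * star w) * star v ^ i * star w ^ j := by
        rw [e2.eq]; noncomm_ring
    _ = v ^ i * w ^ j * ((1 - v * star v) * (1 - w * star w)) * star v ^ i * star w ^ j := by
        rw [e3.eq]; noncomm_ring
    _ = 0 := by rw [h]; noncomm_ring

variable {q p : ℝ} (hq0 : 0 < q) (hq1 : q < 1) (hp0 : 0 < p) (hp1 : p < 1)
include hq0 hq1

theorem hasSum_one_sub_weightedShift_mul_star (hv : star v * v = 1) :
    HasSum (fun n : ℕ => (((1 - q) * q ^ n : ℝ) : ℂ) • (1 - v ^ (n + 1) * star v ^ (n + 1)))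
      (1 - weightedShift q v * star (weightedShift q v)) := by
  have h1 : HasSum (fun n : ℕ => (((1 - q) * q ^ n : ℝ) : ℂ) • (1 : M)) 1 := by
    have h := (hasSum_geometric_of_lt_one hq0.le hq1).mul_left (1 - q)
    rw [mul_inv_cancel₀ (by linarith)] at h
    simpa using (Complex.hasSum_ofReal.2 h).smul_const (1 : M)
  simpa only [smul_sub] using h1.sub (hasSum_weightedShift_mul_star hq0 hq1 hv)

include hp0 hp1

/-- The weighted shifts of doubly commuting isometries with orthogonal defects satisfy the sphere
relation. -/
theorem weightedShift_sphere (hv : star v * v = 1) (hw : star w * w = 1) (hvw : Commute v w)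
    (hvw' : Commute (star v) w) (h : (1 - v * star v) * (1 - w * star w) = 0) :
    (1 - weightedShift q v * star (weightedShift q v)) *
      (1 - weightedShift p w * star (weightedShift p w)) = 0 := by
  have h1 : ∀ m : ℕ, (1 - v ^ m * star v ^ m) *
      (1 - weightedShift p w * star (weightedShift p w)) = 0 := fun m => by
    have := (hasSum_one_sub_weightedShift_mul_star hp0 hp1 hw).mul_left (1 - v ^ m * star v ^ m)
    simp only [mul_smul_comm, defect_pow_mul_defect_pow hvw hvw' h, smul_zero] at this
    exact this.unique hasSum_zero
  have := (hasSum_one_sub_weightedShift_mul_star hq0 hq1 hv).mul_right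
    (1 - weightedShift p w * star (weightedShift p w))
  simp only [smul_mul_assoc, h1, smul_zero] at this
  exact this.unique hasSum_zero

omit hq0 hq1 hp0 hp1 in
theorem star_star_commute {a b : M} (h : Commute (star a) b) : Commute a (star b) := by
  have := h.star_star
  rwa [star_star] at this

omit hq0 hq1 hp0 hp1 in
/-- An element commuting with `x` and `star x` commutes with the `C*`-algebra generated by `x`. -/
theorem commute_of_mem_elemental {x y z : M} (h : Commute y x) (h' : Commute y (star x))
    (hz : z ∈ StarAlgebra.elemental ℂ x) : Commute y z := by
  have hy : y ∈ StarSubalgebra.centralizer ℂ {x} := by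
    rw [StarSubalgebra.mem_centralizer_iff]
    rintro _ rfl
    exact ⟨h.eq.symm, h'.eq.symm⟩
  have := StarAlgebra.elemental.le_centralizer_centralizer ℂ x hz
  rw [StarSubalgebra.mem_centralizer_iff] at this
  exact (this y hy).1

/-- Solutions of the sphere relations come from doubly commuting isometries with orthogonal
defects. -/
theorem exists_isometries_of_sphere {a b : M}
    (ha : star a * a - (q : ℂ) • (a * star a) = (1 - (q : ℂ)) • 1)
    (hb : star b * b - (p : ℂ) • (b * star b) = (1 - (p : ℂ)) • 1)
    (hab : Commute a b) (hab' : Commute (star a) b)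
    (h : (1 - a * star a) * (1 - b * star b) = 0) :
    ∃ v w : M, star v * v = 1 ∧ star w * w = 1 ∧ Commute v w ∧ Commute (star v) w ∧
      (1 - v * star v) * (1 - w * star w) = 0 ∧ weightedShift q v = a ∧ weightedShift p w = b := by
  obtain ⟨v, hva, hv, rfl⟩ := exists_isometry_of_disc hq0 hq1 ha
  obtain ⟨w, hwb, hw, rfl⟩ := exists_isometry_of_disc hp0 hp1 hb
  set a := weightedShift q v with had
  set b := weightedShift p w with hbd
  have haw : Commute a w := commute_of_mem_elemental hab (star_star_commute hab') hwb
  have haw' : Commute (star a) w := commute_of_mem_elemental hab' hab.star_star hwb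
  have hvw : Commute v w := (commute_of_mem_elemental haw.symm haw'.symm hva).symm
  have hvw' : Commute (star v) w :=
    (commute_of_mem_elemental haw.symm haw'.symm (star_mem hva)).symm
  refine ⟨v, w, hv, hw, hvw, hvw', ?_, rfl, rfl⟩
  have e1 : (1 - v * star v) * (1 - a * star a) = 1 - v * star v := by
    have : (1 - v * star v) * a = 0 := by
      rw [had, weightedShift, ← mul_assoc, sub_mul, mul_assoc v, hv]
      simp
    rw [mul_sub, mul_one, ← mul_assoc, this, zero_mul, sub_zero]
  have e2 : (1 - b * star b) * (1 - w * star w) = 1 - w * star w := by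
    have : star b * (1 - w * star w) = 0 := by
      rw [hbd, weightedShift, star_mul, mul_assoc, mul_sub, ← mul_assoc (star w), hw]
      simp
    rw [sub_mul, one_mul, mul_assoc, this, mul_zero, sub_zero]
  calc _ = (1 - v * star v) * (1 - a * star a) * ((1 - b * star b) * (1 - w * star w)) := by
        rw [e1, e2]
    _ = (1 - v * star v) * ((1 - a * star a) * (1 - b * star b)) * (1 - w * star w) := by
        noncomm_ring
    _ = 0 := by rw [h, mul_zero, zero_mul]

end DoublyCommuting

/-! ### Norm attaining representations -/

section States

variable {Q : Type*} [CStarAlgebra Q]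

/-- A unital functional of norm at most one takes real values on self-adjoint elements. -/
theorem im_apply_eq_zero_of_isSelfAdjoint {f : StrongDual ℂ Q} (hf : ‖f‖ ≤ 1) (hf1 : f 1 = 1)
    {x : Q} (hx : IsSelfAdjoint x) : (f x).im = 0 := by
  have key : ∀ t : ℝ, ((f x).im + t) ^ 2 ≤ ‖x‖ ^ 2 + t ^ 2 := by
    intro t
    set y : Q := x + (t * Complex.I : ℂ) • 1 with hy
    have h1 : ‖f y‖ ≤ ‖y‖ := (f.le_of_opNorm_le hf y).trans (one_mul _).le
    have h2 : ((f x).im + t) ^ 2 ≤ ‖f y‖ ^ 2 := by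
      have : (f y).im = (f x).im + t := by
        rw [hy, map_add, map_smul, hf1]
        simp
      rw [← this, ← sq_abs]
      exact pow_le_pow_left₀ (abs_nonneg _) (Complex.abs_im_le_norm _) 2
    have h3 : ‖y‖ ^ 2 ≤ ‖x‖ ^ 2 + t ^ 2 := by
      have h4 : star y * y = star x * x + ((t ^ 2 : ℝ) : ℂ) • 1 := by
        rw [hy, star_add, star_smul, star_one, hx.star_eq, add_mul, mul_add, mul_add,
          smul_mul_assoc, one_mul, smul_mul_assoc, one_mul, mul_smul_comm, mul_one, smul_smul]
        have : star (t * Complex.I : ℂ) = -(t * Complex.I) := by simp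
        rw [this, neg_smul]
        have e : -(t * Complex.I : ℂ) * (t * Complex.I) = ((t ^ 2 : ℝ) : ℂ) := by
          push_cast
          linear_combination (-(t : ℂ) ^ 2) * Complex.I_sq
        rw [e]
        abel
      have h5 : ‖(1 : Q)‖ ≤ 1 := by
        rcases subsingleton_or_nontrivial Q with h | h
        · rw [Subsingleton.elim (1 : Q) 0, norm_zero]; exact zero_le_one
        · exact norm_one.le
      calc ‖y‖ ^ 2 = ‖star y * y‖ := by rw [CStarRing.norm_star_mul_self, sq]
        _ ≤ ‖star x * x‖ + ‖((t ^ 2 : ℝ) : ℂ) • (1 : Q)‖ := by rw [h4]; exact norm_add_le _ _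
        _ ≤ ‖x‖ ^ 2 + t ^ 2 := by
          rw [CStarRing.norm_star_mul_self, ← sq, norm_smul, Complex.norm_real,
            Real.norm_of_nonneg (sq_nonneg t)]
          exact add_le_add le_rfl (mul_le_of_le_one_right (sq_nonneg t) h5)
    exact h2.trans ((pow_le_pow_left₀ (norm_nonneg _) h1 2).trans h3)
  by_contra him
  have := key ((‖x‖ ^ 2 + 1) / (2 * (f x).im))
  have e : 2 * (f x).im * ((‖x‖ ^ 2 + 1) / (2 * (f x).im)) = ‖x‖ ^ 2 + 1 := by
    field_simp
  nlinarith [sq_nonneg (f x).im]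

variable [PartialOrder Q] [StarOrderedRing Q]

/-- A unital functional of norm at most one is positive. -/
theorem apply_nonneg_of_nonneg {f : StrongDual ℂ Q} (hf : ‖f‖ ≤ 1) (hf1 : f 1 = 1)
    {x : Q} (hx : 0 ≤ x) : 0 ≤ f x := by
  rw [Complex.nonneg_iff]
  refine ⟨?_, (im_apply_eq_zero_of_isSelfAdjoint hf hf1 hx.isSelfAdjoint).symm⟩
  have h1 : ‖(‖x‖ : ℂ) • 1 - x‖ ≤ ‖x‖ := by
    have hle : x ≤ (‖x‖ : ℂ) • 1 := by
      have := IsSelfAdjoint.le_algebraMap_norm_self (A := Q) (a := x) hx.isSelfAdjoint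
      rw [Algebra.algebraMap_eq_smul_one] at this
      simpa [Complex.coe_smul] using this
    have h0 : 0 ≤ (‖x‖ : ℂ) • 1 - x := sub_nonneg.2 hle
    rw [CStarAlgebra.norm_le_iff_le_algebraMap _ (norm_nonneg x) h0,
      Algebra.algebraMap_eq_smul_one, ← Complex.coe_smul]
    exact sub_le_self _ hx
  have h2 : ‖f ((‖x‖ : ℂ) • 1 - x)‖ ≤ ‖x‖ :=
    (f.le_of_opNorm_le hf _).trans ((one_mul _).le.trans h1)
  rw [map_sub, map_smul, hf1, smul_eq_mul, mul_one] at h2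
  have h3 := (Complex.re_le_norm _).trans h2
  simp only [Complex.sub_re, Complex.ofReal_re] at h3
  linarith

/-- Every positive element attains its norm in some state. -/
theorem exists_state {b : Q} (hb : 0 ≤ b) (hb0 : b ≠ 0) :
    ∃ f : Q →ₚ[ℂ] ℂ, f 1 = 1 ∧ f b = ‖b‖ := by
  have : Nontrivial Q := ⟨b, 0, hb0⟩
  -- A functional which attains its norm at `‖b‖ + b` is unital and attains its norm at `b`.
  have hn : ‖(‖b‖ : ℂ) • 1 + b‖ = 2 * ‖b‖ := by
    have hmem : ‖b‖ ∈ spectrum ℝ b := CStarAlgebra.norm_mem_spectrum_of_nonneg hb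
    refine le_antisymm ((norm_add_le _ _).trans ?_) ?_
    · rw [norm_smul, norm_one, Complex.norm_real, norm_norm]
      linarith
    · have h2 : ‖b‖ + ‖b‖ ∈ spectrum ℝ (algebraMap ℝ Q ‖b‖ + b) :=
        spectrum.add_mem_add_iff.2 hmem
      have h3 := spectrum.norm_le_norm_of_mem h2
      rw [Algebra.algebraMap_eq_smul_one, ← Complex.coe_smul,
        Real.norm_of_nonneg (by positivity)] at h3
      linarith
  obtain ⟨f, hf, hfb⟩ := exists_dual_vector'' ℂ ((‖b‖ : ℂ) • 1 + b)
  rw [map_add, map_smul, hn, smul_eq_mul] at hfb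
  have hbpos : 0 < ‖b‖ := norm_pos_iff.2 hb0
  have hle : ‖f b‖ ≤ ‖b‖ := (f.le_of_opNorm_le hf b).trans (one_mul _).le
  have hle1 : ‖f 1‖ ≤ 1 := by
    simpa using f.le_of_opNorm_le hf (1 : Q)
  have hre := congrArg Complex.re hfb
  have h1re : (f 1).re ≤ 1 := (Complex.re_le_norm _).trans hle1
  have hbre : (f b).re ≤ ‖b‖ := (Complex.re_le_norm _).trans hle
  simp at hre
  have e1 : (f 1).re = 1 := by nlinarith
  have hf1 : f 1 = 1 := by
    have h4 := Complex.sq_norm_sub_sq_re (f 1)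
    have h5 : ‖f 1‖ ^ 2 ≤ 1 := pow_le_one₀ (norm_nonneg _) hle1
    have h6 : (f 1).im = 0 := by nlinarith [sq_nonneg (f 1).im]
    exact Complex.ext e1 h6
  refine ⟨PositiveLinearMap.mk₀ (f : Q →ₗ[ℂ] ℂ) fun x hx => apply_nonneg_of_nonneg hf hf1 hx,
    hf1, ?_⟩
  change f b = ‖b‖
  rw [hf1] at hfb
  push_cast at hfb
  linear_combination hfb

/-- Every nonzero element of a `C*`-algebra attains its norm in some representation. -/
theorem exists_rep_norm_le {Q : Type} [CStarAlgebra Q] {x : Q} (hx : x ≠ 0) :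
    ∃ (H : Type) (_ : NormedAddCommGroup H) (_ : InnerProductSpace ℂ H) (_ : CompleteSpace H)
      (_ : Nontrivial H) (π : Q →⋆ₐ[ℂ] (H →L[ℂ] H)), ‖x‖ ≤ ‖π x‖ := by
  let _ : PartialOrder Q := CStarAlgebra.spectralOrder Q
  have : StarOrderedRing Q := CStarAlgebra.spectralOrderedRing Q
  have hx2 : star x * x ≠ 0 := by rwa [Ne, CStarRing.star_mul_self_eq_zero_iff]
  obtain ⟨f, hf1, hfx⟩ := exists_state (star_mul_self_nonneg x) hx2
  let ξ : f.GNS := (f.toPreGNS 1 : f.PreGNS)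
  have hξ : ‖ξ‖ = 1 := by
    rw [UniformSpace.Completion.norm_coe, f.preGNS_norm_def]
    simp [hf1]
  have hxξ : ‖f.gnsStarAlgHom x ξ‖ = ‖x‖ := by
    have : f.gnsStarAlgHom x ξ = (f.toPreGNS x : f.PreGNS) := by
      change f.gnsNonUnitalStarAlgHom x ξ = _
      rw [f.gnsNonUnitalStarAlgHom_apply_coe]
      simp
    rw [this, UniformSpace.Completion.norm_coe, f.preGNS_norm_def]
    simp [hfx, CStarRing.norm_star_mul_self]
  refine ⟨f.GNS, inferInstance, inferInstance, inferInstance,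
    ⟨ξ, 0, fun h => by simp [h] at hξ⟩, f.gnsStarAlgHom, ?_⟩
  have := (f.gnsStarAlgHom x).le_opNorm ξ
  rwa [hxξ, hξ, mul_one] at this

end States

/-! ### Operators on Hilbert space tensor products -/

section TensorOperators

variable {H K : Type*} [NormedAddCommGroup H] [InnerProductSpace ℂ H]
  [NormedAddCommGroup K] [InnerProductSpace ℂ K]

/-- The elementary tensor `x ⊗ y` in the Hilbert space tensor product. -/
def HilbertTensor.tmul (x : H) (y : K) : HilbertTensor H K := HilbertTensor.incl (x ⊗ₜ[ℂ] y)

theorem opTensor_tmul (S : H →L[ℂ] H) (T : K →L[ℂ] K) (x : H) (y : K) :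
    opTensor S T (HilbertTensor.tmul x y) = HilbertTensor.tmul (S x) (T y) := by
  rw [HilbertTensor.tmul, opTensor_incl, TensorProduct.mapL_tmul]
  rfl

theorem HilbertTensor.inner_tmul (x x' : H) (y y' : K) :
    inner ℂ (HilbertTensor.tmul x y) (HilbertTensor.tmul x' y') = inner ℂ x x' * inner ℂ y y' := by
  rw [HilbertTensor.tmul, HilbertTensor.tmul, LinearIsometry.inner_map_map,
    TensorProduct.inner_tmul]

theorem HilbertTensor.orthonormal_tmul {ι κ : Type*} {e : ι → H} {f : κ → K}
    (he : Orthonormal ℂ e) (hf : Orthonormal ℂ f) :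
    Orthonormal ℂ fun k : ι × κ => HilbertTensor.tmul (e k.1) (f k.2) := by
  classical
  rw [orthonormal_iff_ite] at he hf ⊢
  rintro ⟨i, j⟩ ⟨i', j'⟩
  rw [HilbertTensor.inner_tmul, he, hf]
  by_cases h1 : i = i' <;> by_cases h2 : j = j' <;> simp [h1, h2]

/-- The map `x ↦ x ⊗ y`. -/
def HilbertTensor.tmulRight (y : K) : H →L[ℂ] HilbertTensor H K :=
  HilbertTensor.incl.toContinuousLinearMap ∘L (TensorProduct.mkL ℂ H K).flip y

theorem HilbertTensor.tmul_sub_left (x x' : H) (y : K) :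
    HilbertTensor.tmul (x - x') y = HilbertTensor.tmul x y - HilbertTensor.tmul x' y :=
  map_sub (HilbertTensor.tmulRight y) x x'

theorem HilbertTensor.zero_tmul (y : K) : HilbertTensor.tmul (0 : H) y = 0 :=
  map_zero (HilbertTensor.tmulRight y)

theorem HilbertTensor.tmul_zero (x : H) : HilbertTensor.tmul x (0 : K) = 0 := by
  rw [HilbertTensor.tmul, TensorProduct.tmul_zero, map_zero]

theorem HilbertTensor.norm_sum_tmul_sq {ι : Type*} {f : ι → K} (hf : Orthonormal ℂ f)
    (s : Finset ι) (x : ι → H) :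
    ‖∑ k ∈ s, HilbertTensor.tmul (x k) (f k)‖ ^ 2 = ∑ k ∈ s, ‖x k‖ ^ 2 := by
  classical
  have h : inner ℂ (∑ k ∈ s, HilbertTensor.tmul (x k) (f k))
      (∑ k ∈ s, HilbertTensor.tmul (x k) (f k)) = ((∑ k ∈ s, ‖x k‖ ^ 2 : ℝ) : ℂ) := by
    rw [sum_inner, Complex.ofReal_sum]
    refine Finset.sum_congr rfl fun k hk => ?_
    rw [inner_sum, Finset.sum_eq_single_of_mem k hk]
    · rw [HilbertTensor.inner_tmul, inner_self_eq_norm_sq_to_K, inner_self_eq_norm_sq_to_K,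
        hf.1 k]
      simp
    · intro l _ hl
      rw [HilbertTensor.inner_tmul, hf.2 hl.symm, mul_zero]
  rw [inner_self_eq_norm_sq_to_K] at h
  exact Complex.ofReal_injective ((Complex.ofReal_pow _ 2).trans h)

variable [CompleteSpace H] [CompleteSpace K]

/-- The amplification `S ↦ S ⊗ 1`. -/
def opTensorLeft : (H →L[ℂ] H) →⋆ₐ[ℂ] (HilbertTensor H K →L[ℂ] HilbertTensor H K) where
  toFun S := opTensor S 1
  map_one' := opTensor_one
  map_mul' S S' := by rw [opTensor_mul, one_mul]
  map_zero' := opTensor_ext fun x => by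
    rw [opTensor_incl, TensorProduct.mapL_zero_left]; simp
  map_add' S S' := opTensor_ext fun x => by
    rw [opTensor_incl, TensorProduct.mapL_add_left]; simp [opTensor_incl]
  commutes' c := opTensor_ext fun x => by
    rw [opTensor_incl, Algebra.algebraMap_eq_smul_one, Algebra.algebraMap_eq_smul_one,
      TensorProduct.mapL_smul_left, ← opTensor_one]
    simp [opTensor_incl]
  map_star' S := by rw [star_opTensor, star_one]

/-- The amplification `T ↦ 1 ⊗ T`. -/
def opTensorRight : (K →L[ℂ] K) →⋆ₐ[ℂ] (HilbertTensor H K →L[ℂ] HilbertTensor H K) where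
  toFun T := opTensor 1 T
  map_one' := opTensor_one
  map_mul' S S' := by rw [opTensor_mul, one_mul]
  map_zero' := opTensor_ext fun x => by
    rw [opTensor_incl, TensorProduct.mapL_zero_right]; simp
  map_add' S S' := opTensor_ext fun x => by
    rw [opTensor_incl, TensorProduct.mapL_add_right]; simp [opTensor_incl]
  commutes' c := opTensor_ext fun x => by
    rw [opTensor_incl, Algebra.algebraMap_eq_smul_one, Algebra.algebraMap_eq_smul_one,
      TensorProduct.mapL_smul_right, ← opTensor_one]
    simp [opTensor_incl]
  map_star' S := by rw [star_opTensor, star_one]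

theorem opTensorLeft_apply (S : H →L[ℂ] H) :
    (opTensorLeft S : HilbertTensor H K →L[ℂ] HilbertTensor H K) = opTensor S 1 := rfl

theorem opTensorRight_apply (T : K →L[ℂ] K) :
    (opTensorRight T : HilbertTensor H K →L[ℂ] HilbertTensor H K) = opTensor 1 T := rfl

theorem opTensor_eq_mul (S : H →L[ℂ] H) (T : K →L[ℂ] K) :
    opTensor S T = opTensorLeft S * opTensorRight T := by
  rw [opTensorLeft_apply, opTensorRight_apply, opTensor_mul, one_mul, mul_one]

theorem continuous_opTensorLeft :
    Continuous (opTensorLeft : (H →L[ℂ] H) → HilbertTensor H K →L[ℂ] HilbertTensor H K) :=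
  map_continuous opTensorLeft

theorem continuous_opTensorRight :
    Continuous (opTensorRight : (K →L[ℂ] K) → HilbertTensor H K →L[ℂ] HilbertTensor H K) :=
  map_continuous opTensorRight

end TensorOperators

/-! ### Window operators of an isometry -/

section Window

/-- Weight of the defect part in `windowOp`; it vanishes for `n ≤ i`, since `Real.sqrt` is zero on
negative numbers. -/
def defectWeight (n i : ℕ) : ℝ := √(1 - i / n)

/-- Weight of the range part in `windowOp`. -/
def rangeWeight (n i : ℕ) : ℝ := if i < n then √(1 / n) else 0

theorem defectWeight_sq {n i : ℕ} (hn : 0 < n) (hi : i ≤ n) :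
    defectWeight n i ^ 2 = 1 - i / n := by
  refine Real.sq_sqrt (sub_nonneg.2 ?_)
  rw [div_le_one (by exact_mod_cast hn)]
  exact_mod_cast hi

theorem rangeWeight_sq {n i : ℕ} (hi : i < n) : rangeWeight n i ^ 2 = 1 / n := by
  rw [rangeWeight, if_pos hi, Real.sq_sqrt (by positivity)]

theorem defectWeight_self {n : ℕ} (hn : 0 < n) : defectWeight n n = 0 := by
  have : (n : ℝ) ≠ 0 := by positivity
  simp [defectWeight, this]

theorem rangeWeight_self (n : ℕ) : rangeWeight n n = 0 := by simp [rangeWeight]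

theorem defectWeight_sub_sq_le {n i : ℕ} (hi : i < n) :
    (defectWeight n (i + 1) - defectWeight n i) ^ 2 ≤ 1 / n := by
  have hn : 0 < n := by omega
  have h1 := defectWeight_sq hn hi.le
  have h2 := defectWeight_sq hn (Nat.succ_le_of_lt hi)
  rw [Nat.succ_eq_add_one] at h2
  have h3 : 0 ≤ defectWeight n i := Real.sqrt_nonneg _
  have h4 : 0 ≤ defectWeight n (i + 1) := Real.sqrt_nonneg _
  push_cast at h2
  have h5 : defectWeight n i ^ 2 - defectWeight n (i + 1) ^ 2 = 1 / n := by
    rw [h1, h2]; ring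
  have h6 : defectWeight n (i + 1) ≤ defectWeight n i := by
    have : 0 ≤ (1 : ℝ) / n := by positivity
    nlinarith
  nlinarith

variable {H : Type*} [NormedAddCommGroup H] [InnerProductSpace ℂ H] [CompleteSpace H]

/-- The operator which is `a` on the defect space of `V` and `b` on the range of `V`. -/
def splitOp (V : H →L[ℂ] H) (a b : ℝ) : H →L[ℂ] H :=
  (a : ℂ) • (1 - V * star V) + (b : ℂ) • (V * star V)

/-- The components of the isometry `h ↦ ∑ i < n, windowOp V n i h ⊗ e i` which approximately
intertwines `V` with a multiple of the shift. Under the Wold decomposition, the defect part is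
the identification of a shift with itself, slowly cut off, and the range part spreads the
remaining vectors evenly over a window of length `n`. -/
def windowOp (V : H →L[ℂ] H) (n i : ℕ) : H →L[ℂ] H :=
  splitOp V (defectWeight n i) (rangeWeight n i) * star V ^ i

variable {V : H →L[ℂ] H}

theorem windowOp_self {n : ℕ} (hn : 0 < n) : windowOp V n n = 0 := by
  simp [windowOp, splitOp, defectWeight_self hn, rangeWeight_self]

theorem windowOp_succ_mul_sub (hV : star V * V = 1) (n i : ℕ) :
    windowOp V n (i + 1) * V - windowOp V n i =
      splitOp V (defectWeight n (i + 1) - defectWeight n i)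
        (rangeWeight n (i + 1) - rangeWeight n i) * star V ^ i := by
  rw [windowOp, windowOp, mul_assoc, pow_succ, mul_assoc (star V ^ i), hV, mul_one, ← sub_mul]
  congr 1
  simp only [splitOp, Complex.ofReal_sub, sub_smul]
  abel

theorem windowOp_zero_mul (hV : star V * V = 1) {n : ℕ} (hn : 0 < n) :
    windowOp V n 0 * V = (√(1 / n) : ℂ) • V := by
  have h : (1 - V * star V) * V = 0 := by rw [sub_mul, mul_assoc, hV]; simp
  rw [windowOp, splitOp, pow_zero, mul_one, add_mul, smul_mul_assoc, smul_mul_assoc, h,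
    mul_assoc, hV, mul_one, smul_zero, zero_add, rangeWeight, if_pos hn]

theorem windowOp_succ_mul_defect (hV : star V * V = 1) (n i : ℕ) :
    windowOp V n (i + 1) * (1 - V * star V) = 0 := by
  have h : star V * (1 - V * star V) = 0 := by rw [mul_sub, ← mul_assoc, hV]; simp
  rw [windowOp, pow_succ, mul_assoc, mul_assoc, h, mul_zero, mul_zero]

theorem norm_splitOp_sq (hV : star V * V = 1) (a b : ℝ) (y : H) :
    ‖splitOp V a b y‖ ^ 2 = a ^ 2 * (‖y‖ ^ 2 - ‖star V y‖ ^ 2) + b ^ 2 * ‖star V y‖ ^ 2 := by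
  have h : V * star V * (V * star V) = V * star V := by
    rw [mul_assoc, ← mul_assoc (star V), hV, one_mul]
  have hs : star (splitOp V a b) * splitOp V a b =
      ((a ^ 2 : ℝ) : ℂ) • 1 + ((b ^ 2 - a ^ 2 : ℝ) : ℂ) • (V * star V) := by
    have hsa : star (splitOp V a b) = splitOp V a b := by
      simp [splitOp]
    rw [hsa, splitOp, add_mul, mul_add, mul_add, smul_mul_smul_comm, smul_mul_smul_comm,
      smul_mul_smul_comm, smul_mul_smul_comm, h, mul_sub, sub_mul, sub_mul, mul_sub, h]
    simp only [mul_one, one_mul, sub_self, smul_zero, sub_zero, add_zero, Complex.ofReal_sub,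
      Complex.ofReal_pow, sub_smul, smul_sub, ← sq, one_pow]
    abel
  have e1 : ‖splitOp V a b y‖ ^ 2 = (inner ℂ ((star (splitOp V a b) * splitOp V a b) y) y).re := by
    rw [ContinuousLinearMap.apply_norm_sq_eq_inner_adjoint_left]
    rfl
  have e2 : ‖star V y‖ ^ 2 = (inner ℂ ((V * star V) y) y).re := by
    rw [ContinuousLinearMap.apply_norm_sq_eq_inner_adjoint_left]
    change (inner ℂ ((star (star V) * star V) y) y).re = _
    rw [star_star]
  have e3 : ‖y‖ ^ 2 = (inner ℂ y y).re := by
    rw [← inner_self_eq_norm_sq (𝕜 := ℂ)]; rfl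
  rw [e1, hs, e2, e3]
  simp only [add_apply, smul_apply, one_apply_eq_self, inner_add_left, inner_smul_left,
    Complex.conj_ofReal, Complex.add_re, Complex.re_ofReal_mul]
  ring

theorem norm_windowOp_sq (hV : star V * V = 1) (n i : ℕ) (g : H) :
    ‖windowOp V n i g‖ ^ 2 = defectWeight n i ^ 2 *
      (‖(star V ^ i) g‖ ^ 2 - ‖(star V ^ (i + 1)) g‖ ^ 2) +
      rangeWeight n i ^ 2 * ‖(star V ^ (i + 1)) g‖ ^ 2 := by
  rw [pow_succ' (star V)]
  exact norm_splitOp_sq hV _ _ _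

theorem norm_star_pow_succ_le (hV : star V * V = 1) (i : ℕ) (g : H) :
    ‖(star V ^ (i + 1)) g‖ ≤ ‖(star V ^ i) g‖ := by
  rw [pow_succ']
  have : ‖star V‖ ≤ 1 := by rw [norm_star]; exact norm_le_one_of_isometry hV
  exact ((star V).le_of_opNorm_le this _).trans (one_mul _).le

theorem norm_star_pow_le (hV : star V * V = 1) (i : ℕ) (g : H) : ‖(star V ^ i) g‖ ≤ ‖g‖ := by
  induction i with
  | zero => simp
  | succ i ih => exact (norm_star_pow_succ_le hV i g).trans ih

/-- The weights are chosen so that the window operators form a column isometry. -/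
theorem sum_norm_windowOp_sq (hV : star V * V = 1) {n : ℕ} (hn : 0 < n) (g : H) :
    ∑ i ∈ Finset.range n, ‖windowOp V n i g‖ ^ 2 = ‖g‖ ^ 2 := by
  have key : ∀ m ≤ n, ∑ i ∈ Finset.range m, ‖windowOp V n i g‖ ^ 2 =
      ‖g‖ ^ 2 - (1 - m / n) * ‖(star V ^ m) g‖ ^ 2 := by
    intro m hm
    induction m with
    | zero => simp
    | succ m ih =>
      rw [Finset.sum_range_succ, ih (by omega), norm_windowOp_sq hV, defectWeight_sq hn (by omega),
        rangeWeight_sq (by omega)]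
      push_cast
      ring
  have hn' : (n : ℝ) ≠ 0 := by positivity
  rw [key n le_rfl, div_self hn']
  ring

/-- The failure of the window operators of `V` to intertwine `V` with a shift. -/
def windowError (V : H →L[ℂ] H) (n : ℕ) : ℕ → H →L[ℂ] H
  | 0 => windowOp V n 0 * V
  | i + 1 => windowOp V n (i + 1) * V - windowOp V n i

theorem sum_norm_windowError_sq_le (hV : star V * V = 1) {n : ℕ} (hn : 0 < n) (g : H) :
    ∑ i ∈ Finset.range (n + 1), ‖windowError V n i g‖ ^ 2 ≤ 3 / n * ‖g‖ ^ 2 := by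
  have hn0 : (0 : ℝ) ≤ 1 / n := by positivity
  have h0 : ‖windowError V n 0 g‖ ^ 2 ≤ 1 / n * ‖g‖ ^ 2 := by
    rw [windowError, windowOp_zero_mul hV hn, smul_apply, norm_smul, mul_pow,
      Complex.norm_real, Real.norm_of_nonneg (Real.sqrt_nonneg _), Real.sq_sqrt hn0]
    gcongr
    exact (V.le_of_opNorm_le (norm_le_one_of_isometry hV) g).trans (one_mul _).le
  -- The defect weights vary slowly, and the range weights only jump at the end of the window.
  have hr : ∀ i < n, (rangeWeight n (i + 1) - rangeWeight n i) ^ 2 * ‖(star V ^ (i + 1)) g‖ ^ 2 ≤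
      if i = n - 1 then 1 / n * ‖g‖ ^ 2 else 0 := by
    intro i hi
    split_ifs with h
    · have : i + 1 = n := by omega
      rw [this, rangeWeight_self, zero_sub, neg_sq, rangeWeight_sq hi]
      gcongr
      exact norm_star_pow_le hV n g
    · rw [rangeWeight, rangeWeight, if_pos hi, if_pos (by omega)]
      simp
  have hs : ∀ m ≤ n, ∑ i ∈ Finset.range m, ‖windowError V n (i + 1) g‖ ^ 2 ≤
      1 / n * (‖g‖ ^ 2 - ‖(star V ^ m) g‖ ^ 2) +
        ∑ i ∈ Finset.range m, if i = n - 1 then 1 / n * ‖g‖ ^ 2 else 0 := by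
    intro m hm
    induction m with
    | zero => simp
    | succ m ih =>
      rw [Finset.sum_range_succ, Finset.sum_range_succ]
      have h1 : ‖windowError V n (m + 1) g‖ ^ 2 =
          (defectWeight n (m + 1) - defectWeight n m) ^ 2 *
            (‖(star V ^ m) g‖ ^ 2 - ‖(star V ^ (m + 1)) g‖ ^ 2) +
          (rangeWeight n (m + 1) - rangeWeight n m) ^ 2 * ‖(star V ^ (m + 1)) g‖ ^ 2 := by
        rw [windowError, windowOp_succ_mul_sub hV, pow_succ' (star V)]
        exact norm_splitOp_sq hV _ _ _
      have h2 : 0 ≤ ‖(star V ^ m) g‖ ^ 2 - ‖(star V ^ (m + 1)) g‖ ^ 2 :=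
        sub_nonneg.2 (pow_le_pow_left₀ (norm_nonneg _) (norm_star_pow_succ_le hV m g) 2)
      have h3 := mul_le_mul_of_nonneg_right (defectWeight_sub_sq_le (n := n) (i := m) (by omega)) h2
      have h4 := hr m (by omega)
      have h5 := ih (by omega)
      rw [h1]
      linarith
  rw [Finset.sum_range_succ']
  have h6 := hs n le_rfl
  have h7 : ∑ i ∈ Finset.range n, (if i = n - 1 then 1 / (n : ℝ) * ‖g‖ ^ 2 else 0) =
      1 / n * ‖g‖ ^ 2 := by
    rw [Finset.sum_ite_eq' (Finset.range n), if_pos (Finset.mem_range.2 (by omega))]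
  have h8 : 0 ≤ 1 / (n : ℝ) * ‖(star V ^ n) g‖ ^ 2 := by positivity
  have h9 : 3 / (n : ℝ) * ‖g‖ ^ 2 = 1 / n * ‖g‖ ^ 2 + 1 / n * ‖g‖ ^ 2 + 1 / n * ‖g‖ ^ 2 := by ring
  rw [h7] at h6
  rw [h9]
  linarith

end Window

/-! ### Approximate embeddings into a multiple of the shift -/

section Embedding

variable {H E : Type*} [NormedAddCommGroup H] [InnerProductSpace ℂ H]
  [NormedAddCommGroup E] [InnerProductSpace ℂ E]

/-- The operator `h ↦ ∑ i < m, ∑ j < n, Z i (Y j h) ⊗ f (i, j)`. -/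
def gridOp (f : ℕ × ℕ → E) (Z Y : ℕ → H →L[ℂ] H) (m n : ℕ) : H →L[ℂ] HilbertTensor H E :=
  ∑ k ∈ Finset.range m ×ˢ Finset.range n, HilbertTensor.tmulRight (f k) ∘L (Z k.1 * Y k.2)

theorem gridOp_apply (f : ℕ × ℕ → E) (Z Y : ℕ → H →L[ℂ] H) (m n : ℕ) (h : H) :
    gridOp f Z Y m n h = ∑ k ∈ Finset.range m ×ˢ Finset.range n,
      HilbertTensor.tmul (Z k.1 (Y k.2 h)) (f k) := by
  rw [gridOp, sum_apply]
  rfl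

variable {f : ℕ × ℕ → E} (hf : Orthonormal ℂ f)

include hf in
theorem norm_gridOp_sq (Z Y : ℕ → H →L[ℂ] H) (m n : ℕ) (h : H) :
    ‖gridOp f Z Y m n h‖ ^ 2 =
      ∑ j ∈ Finset.range n, ∑ i ∈ Finset.range m, ‖Z i (Y j h)‖ ^ 2 := by
  rw [gridOp_apply, HilbertTensor.norm_sum_tmul_sq hf, Finset.sum_product_right]

include hf in
theorem norm_gridOp_le {Z Y : ℕ → H →L[ℂ] H} {m n : ℕ} {c : ℝ} (hc : 0 ≤ c)
    (hZ : ∀ g, ∑ i ∈ Finset.range m, ‖Z i g‖ ^ 2 ≤ c * ‖g‖ ^ 2)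
    (hY : ∀ h, ∑ j ∈ Finset.range n, ‖Y j h‖ ^ 2 ≤ ‖h‖ ^ 2) :
    ‖gridOp f Z Y m n‖ ≤ √c := by
  refine ContinuousLinearMap.opNorm_le_bound _ (Real.sqrt_nonneg c) fun h => ?_
  refine le_of_sq_le_sq ?_ (by positivity)
  rw [norm_gridOp_sq hf, mul_pow, Real.sq_sqrt hc]
  calc _ ≤ ∑ j ∈ Finset.range n, c * ‖Y j h‖ ^ 2 := Finset.sum_le_sum fun j _ => hZ _
    _ = c * ∑ j ∈ Finset.range n, ‖Y j h‖ ^ 2 := (Finset.mul_sum _ _ _).symm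
    _ ≤ _ := mul_le_mul_of_nonneg_left (hY h) hc

theorem gridOp_swap {Z Y : ℕ → H →L[ℂ] H} (h : ∀ i j, Commute (Z i) (Y j)) (m n : ℕ) :
    gridOp (f ∘ Prod.swap) Y Z n m = gridOp f Z Y m n := by
  rw [gridOp, gridOp, Finset.sum_product_right, Finset.sum_product]
  refine Finset.sum_congr rfl fun i _ => Finset.sum_congr rfl fun j _ => ?_
  rw [(h i j).eq]
  rfl

variable [CompleteSpace H] [CompleteSpace E] {V : H →L[ℂ] H} {S : E →L[ℂ] E} {Y : ℕ → H →L[ℂ] H}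

theorem gridOp_mul_sub (hSf : ∀ i j, S (f (i, j)) = f (i + 1, j))
    (hYV : ∀ j, Commute (Y j) V) {n : ℕ} (hn : 0 < n) :
    gridOp f (windowOp V n) Y n n ∘L V - opTensorRight S ∘L gridOp f (windowOp V n) Y n n =
      gridOp f (windowError V n) Y (n + 1) n := by
  ext h
  change gridOp f (windowOp V n) Y n n (V h) - opTensorRight S (gridOp f (windowOp V n) Y n n h) = _
  have hc : ∀ j, Y j (V h) = V (Y j h) := fun j => congrArg (fun T : H →L[ℂ] H => T h) (hYV j).eq
  have h1 : gridOp f (windowOp V n) Y n n (V h) = ∑ j ∈ Finset.range n,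
      (∑ i ∈ Finset.range n, HilbertTensor.tmul (windowOp V n (i + 1) (V (Y j h))) (f (i + 1, j)) +
        HilbertTensor.tmul (windowOp V n 0 (V (Y j h))) (f (0, j))) := by
    rw [gridOp_apply, Finset.sum_product_right]
    refine Finset.sum_congr rfl fun j _ => ?_
    rw [← Finset.sum_range_succ' (fun i => HilbertTensor.tmul (windowOp V n i (V (Y j h)))
      (f (i, j))) n, Finset.sum_range_succ, windowOp_self hn]
    simp only [hc, zero_apply, HilbertTensor.zero_tmul, add_zero]
  have h2 : opTensorRight S (gridOp f (windowOp V n) Y n n h) = ∑ j ∈ Finset.range n,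
      ∑ i ∈ Finset.range n, HilbertTensor.tmul (windowOp V n i (Y j h)) (f (i + 1, j)) := by
    rw [gridOp_apply, map_sum, Finset.sum_product_right]
    refine Finset.sum_congr rfl fun j _ => Finset.sum_congr rfl fun i _ => ?_
    rw [opTensorRight_apply, opTensor_tmul, hSf]
    rfl
  rw [h1, h2, gridOp_apply, Finset.sum_product_right, ← Finset.sum_sub_distrib]
  refine Finset.sum_congr rfl fun j _ => ?_
  rw [Finset.sum_range_succ', add_sub_right_comm, ← Finset.sum_sub_distrib]
  congr 1
  refine Finset.sum_congr rfl fun i _ => ?_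
  rw [← HilbertTensor.tmul_sub_left]
  rfl

/-- On the defect space of `V` only the components on `f (0, j)` survive, which `star S` kills. -/
theorem star_mul_gridOp_mul_defect (hV : star V * V = 1) (hSf : ∀ j, star S (f (0, j)) = 0)
    (hYV : ∀ j, Commute (Y j) V) (hYV' : ∀ j, Commute (Y j) (star V)) (n : ℕ) :
    opTensorRight (star S) ∘L gridOp f (windowOp V n) Y n n ∘L (1 - V * star V) = 0 := by
  ext h
  change opTensorRight (star S) (gridOp f (windowOp V n) Y n n ((1 - V * star V) h)) = 0
  rw [gridOp_apply, map_sum]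
  refine Finset.sum_eq_zero fun k _ => ?_
  obtain ⟨i, j⟩ := k
  have hc : Y j ((1 - V * star V) h) = (1 - V * star V) (Y j h) :=
    congrArg (fun T : H →L[ℂ] H => T h) (((Commute.one_right _).sub_right
      ((hYV j).mul_right (hYV' j))).eq)
  rw [opTensorRight_apply, opTensor_tmul, hc]
  cases i with
  | zero => rw [hSf, HilbertTensor.tmul_zero]
  | succ i =>
    have : windowOp V n (i + 1) ((1 - V * star V) (Y j h)) = 0 :=
      congrArg (fun T : H →L[ℂ] H => T (Y j h)) (windowOp_succ_mul_defect hV n i)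
    rw [this, map_zero, HilbertTensor.zero_tmul]

include hf in
theorem norm_gridOp_mul_sub_le (hV : star V * V = 1) (hSf : ∀ i j, S (f (i, j)) = f (i + 1, j))
    (hYV : ∀ j, Commute (Y j) V) {n : ℕ} (hn : 0 < n)
    (hY : ∀ h, ∑ j ∈ Finset.range n, ‖Y j h‖ ^ 2 ≤ ‖h‖ ^ 2) :
    ‖opTensorRight S ∘L gridOp f (windowOp V n) Y n n - gridOp f (windowOp V n) Y n n ∘L V‖ ≤
      √(3 / n) := by
  rw [norm_sub_rev, gridOp_mul_sub hSf hYV hn]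
  exact norm_gridOp_le hf (by positivity) (sum_norm_windowError_sq_le hV hn) hY

include hf in
theorem norm_gridOp_mul_star_sub_le (hV : star V * V = 1) (hS : star S * S = 1)
    (hSf : ∀ i j, S (f (i, j)) = f (i + 1, j)) (hSf' : ∀ j, star S (f (0, j)) = 0)
    (hYV : ∀ j, Commute (Y j) V) (hYV' : ∀ j, Commute (Y j) (star V)) {n : ℕ} (hn : 0 < n)
    (hY : ∀ h, ∑ j ∈ Finset.range n, ‖Y j h‖ ^ 2 ≤ ‖h‖ ^ 2) :
    ‖opTensorRight (star S) ∘L gridOp f (windowOp V n) Y n n -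
      gridOp f (windowOp V n) Y n n ∘L star V‖ ≤ √(3 / n) := by
  set J := gridOp f (windowOp V n) Y n n with hJ
  set ρ : (E →L[ℂ] E) →⋆ₐ[ℂ] (HilbertTensor H E →L[ℂ] HilbertTensor H E) := opTensorRight
  have h1 : ρ (star S) ∘L J ∘L (1 - V * star V) = 0 :=
    star_mul_gridOp_mul_defect hV hSf' hYV hYV' n
  have h2 : ∀ x, ρ (star S) (ρ S x) = x := fun x => by
    change (ρ (star S) * ρ S) x = x
    rw [← map_mul, hS, map_one, one_apply_eq_self]
  have h3 : ρ (star S) ∘L J - J ∘L star V = ρ (star S) ∘L (J ∘L V - ρ S ∘L J) ∘L star V := by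
    ext x
    have h4 := congrArg (fun T : H →L[ℂ] HilbertTensor H E => T x) h1
    change ρ (star S) (J (x - V (star V x))) = 0 at h4
    rw [map_sub, map_sub, sub_eq_zero] at h4
    change ρ (star S) (J x) - J (star V x) =
      ρ (star S) (J (V (star V x)) - ρ S (J (star V x)))
    rw [map_sub, h2, h4]
  have h5 : ‖ρ (star S)‖ ≤ 1 := by
    rw [map_star, norm_star]
    exact norm_le_one_of_isometry (by rw [← map_star, ← map_mul, hS, map_one])
  have h6 : ‖star V‖ ≤ 1 := by rw [norm_star]; exact norm_le_one_of_isometry hV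
  have h7 : ‖J ∘L V - ρ S ∘L J‖ ≤ √(3 / n) := by
    rw [norm_sub_rev]
    exact norm_gridOp_mul_sub_le hf hV hSf hYV hn hY
  rw [h3]
  calc _ ≤ ‖ρ (star S)‖ * (‖J ∘L V - ρ S ∘L J‖ * ‖star V‖) :=
        (ContinuousLinearMap.opNorm_comp_le _ _).trans (mul_le_mul_of_nonneg_left
          (ContinuousLinearMap.opNorm_comp_le _ _) (norm_nonneg _))
    _ ≤ 1 * (√(3 / n) * 1) := by gcongr
    _ = _ := by ring

end Embedding

/-! ### Asymptotic intertwiners -/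

section Intertwiners

variable {H E G : Type*} [NormedAddCommGroup H] [InnerProductSpace ℂ H]
  [NormedAddCommGroup E] [InnerProductSpace ℂ E] [CompleteSpace E]
  [NormedAddCommGroup G] [InnerProductSpace ℂ G] [CompleteSpace G]
  (ρ : (E →L[ℂ] E) →⋆ₐ[ℂ] (G →L[ℂ] G)) (J : ℕ → H →L[ℂ] G)

/-- The pairs `(R, X)` such that the operators `J n : H → G` intertwine `X` with `ρ R`
asymptotically in norm. -/
def asympIntertwiners : Subalgebra ℂ ((E →L[ℂ] E) × (H →L[ℂ] H)) where
  carrier := {P | Tendsto (fun n => ‖ρ P.1 ∘L J n - J n ∘L P.2‖) atTop (𝓝 0)}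
  mul_mem' {P P'} hP hP' := by
    have h := (hP'.const_mul ‖ρ P.1‖).add (hP.mul_const ‖P'.2‖)
    rw [mul_zero, zero_mul, add_zero] at h
    refine squeeze_zero (fun n => norm_nonneg _) (fun n => ?_) h
    have e : ρ (P * P').1 ∘L J n - J n ∘L (P * P').2 =
        ρ P.1 ∘L (ρ P'.1 ∘L J n - J n ∘L P'.2) + (ρ P.1 ∘L J n - J n ∘L P.2) ∘L P'.2 := by
      ext x
      change ρ (P.1 * P'.1) (J n x) - J n (P.2 (P'.2 x)) =
        ρ P.1 (ρ P'.1 (J n x) - J n (P'.2 x)) + (ρ P.1 (J n (P'.2 x)) - J n (P.2 (P'.2 x)))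
      rw [map_mul, map_sub, mul_apply_eq_comp]
      abel
    rw [e]
    exact (norm_add_le _ _).trans (add_le_add (ContinuousLinearMap.opNorm_comp_le _ _)
      (ContinuousLinearMap.opNorm_comp_le _ _))
  add_mem' {P P'} hP hP' := by
    have h := hP.add hP'
    rw [add_zero] at h
    refine squeeze_zero (fun n => norm_nonneg _) (fun n => ?_) h
    have e : ρ (P + P').1 ∘L J n - J n ∘L (P + P').2 =
        (ρ P.1 ∘L J n - J n ∘L P.2) + (ρ P'.1 ∘L J n - J n ∘L P'.2) := by
      ext x
      change ρ (P.1 + P'.1) (J n x) - J n (P.2 x + P'.2 x) =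
        (ρ P.1 (J n x) - J n (P.2 x)) + (ρ P'.1 (J n x) - J n (P'.2 x))
      rw [map_add, map_add, add_apply]
      abel
    rw [e]
    exact norm_add_le _ _
  algebraMap_mem' c := by
    have e : ∀ n, ρ (algebraMap ℂ ((E →L[ℂ] E) × (H →L[ℂ] H)) c).1 ∘L J n -
        J n ∘L (algebraMap ℂ ((E →L[ℂ] E) × (H →L[ℂ] H)) c).2 = 0 := by
      intro n
      ext x
      change ρ (algebraMap ℂ (E →L[ℂ] E) c) (J n x) - J n (algebraMap ℂ (H →L[ℂ] H) c x) = 0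
      rw [AlgHomClass.commutes, Algebra.algebraMap_eq_smul_one, Algebra.algebraMap_eq_smul_one,
        smul_apply, smul_apply, one_apply_eq_self, one_apply_eq_self, map_smul, sub_self]
    change Tendsto (fun n => _) _ _
    simp only [e, norm_zero]
    exact tendsto_const_nhds

variable {ρ J}

theorem mem_asympIntertwiners {R : E →L[ℂ] E} {X : H →L[ℂ] H} :
    (R, X) ∈ asympIntertwiners ρ J ↔
      Tendsto (fun n => ‖ρ R ∘L J n - J n ∘L X‖) atTop (𝓝 0) := Iff.rfl

theorem isClosed_asympIntertwiners (hJ : ∀ n, ‖J n‖ ≤ 1) :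
    IsClosed (asympIntertwiners ρ J : Set ((E →L[ℂ] E) × (H →L[ℂ] H))) := by
  refine isClosed_of_closure_subset fun P hP => ?_
  change Tendsto (fun n => ‖ρ P.1 ∘L J n - J n ∘L P.2‖) atTop (𝓝 0)
  rw [Metric.tendsto_atTop]
  intro ε hε
  obtain ⟨P', hP', hd⟩ := Metric.mem_closure_iff.1 hP (ε / 3) (by positivity)
  obtain ⟨N, hN⟩ := Metric.tendsto_atTop.1 hP' (ε / 3) (by positivity)
  refine ⟨N, fun n hn => ?_⟩
  have h0 := hN n hn
  rw [dist_zero_right, norm_norm] at h0 ⊢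
  rw [Prod.dist_eq, max_lt_iff, dist_eq_norm, dist_eq_norm] at hd
  have e : ρ P.1 ∘L J n - J n ∘L P.2 = ρ (P.1 - P'.1) ∘L J n +
      (ρ P'.1 ∘L J n - J n ∘L P'.2) - J n ∘L (P.2 - P'.2) := by
    ext x
    change ρ P.1 (J n x) - J n (P.2 x) = ρ (P.1 - P'.1) (J n x) +
      (ρ P'.1 (J n x) - J n (P'.2 x)) - J n (P.2 x - P'.2 x)
    rw [map_sub, map_sub, sub_apply]
    abel
  have h1 : ‖ρ (P.1 - P'.1) ∘L J n‖ ≤ ‖P.1 - P'.1‖ * 1 :=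
    (ContinuousLinearMap.opNorm_comp_le _ _).trans (mul_le_mul
      (NonUnitalStarAlgHom.norm_apply_le ρ _) (hJ n) (norm_nonneg _) (norm_nonneg _))
  have h2 : ‖J n ∘L (P.2 - P'.2)‖ ≤ 1 * ‖P.2 - P'.2‖ :=
    (ContinuousLinearMap.opNorm_comp_le _ _).trans (mul_le_mul_of_nonneg_right (hJ n)
      (norm_nonneg _))
  rw [e]
  calc _ ≤ ‖ρ (P.1 - P'.1) ∘L J n‖ + ‖ρ P'.1 ∘L J n - J n ∘L P'.2‖ + ‖J n ∘L (P.2 - P'.2)‖ :=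
        (norm_sub_le _ _).trans (add_le_add (norm_add_le _ _) le_rfl)
    _ < ε := by linarith [hd.1, hd.2]

theorem mul_mem_asympIntertwiners {R : E →L[ℂ] E} (T : E →L[ℂ] E)
    (h : (R, 0) ∈ asympIntertwiners ρ J) : (T * R, 0) ∈ asympIntertwiners ρ J := by
  rw [mem_asympIntertwiners] at h ⊢
  simp only [ContinuousLinearMap.comp_zero, sub_zero] at h ⊢
  have h' := h.const_mul ‖ρ T‖
  rw [mul_zero] at h'
  refine squeeze_zero (fun n => norm_nonneg _) (fun n => ?_) h'
  rw [map_mul, ContinuousLinearMap.mul_def, ContinuousLinearMap.comp_assoc]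
  exact ContinuousLinearMap.opNorm_comp_le _ _

theorem norm_le_of_mem_asympIntertwiners (hiso : ∀ n x, ‖J n x‖ = ‖x‖) {R : E →L[ℂ] E}
    {X : H →L[ℂ] H} (h : (R, X) ∈ asympIntertwiners ρ J) : ‖X‖ ≤ ‖R‖ := by
  refine ContinuousLinearMap.opNorm_le_bound _ (norm_nonneg _) fun x => ?_
  have h1 : Tendsto (fun n => ‖ρ R ∘L J n - J n ∘L X‖ * ‖x‖ + ‖R‖ * ‖x‖) atTop
      (𝓝 (‖R‖ * ‖x‖)) := by
    simpa using ((mem_asympIntertwiners.1 h).mul_const ‖x‖).add_const (‖R‖ * ‖x‖)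
  refine ge_of_tendsto' h1 fun n => ?_
  have h2 : ‖(ρ R ∘L J n - J n ∘L X) x‖ ≤ _ := ContinuousLinearMap.le_opNorm _ x
  have h3 : ‖ρ R (J n x)‖ ≤ ‖R‖ * ‖x‖ := by
    refine ((ρ R).le_of_opNorm_le (NonUnitalStarAlgHom.norm_apply_le ρ R) _).trans ?_
    rw [hiso]
  have h4 : J n (X x) = ρ R (J n x) - (ρ R ∘L J n - J n ∘L X) x := by
    change _ = ρ R (J n x) - (ρ R (J n x) - J n (X x))
    abel
  rw [← hiso n (X x), h4]
  exact (norm_sub_le _ _).trans (by linarith)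

end Intertwiners

/-! ### The unilateral shift -/

section ShiftOperator

/-- The standard orthonormal basis of `ℓ²(ℕ)`. -/
def basisVec (k : ℕ) : ℓ²(ℕ, ℂ) := lp.single 2 k (1 : ℂ)

theorem shift_basisVec (k : ℕ) : shift (basisVec k) = basisVec (k + 1) := shift_single k

theorem orthonormal_basisVec : Orthonormal ℂ basisVec := by
  rw [orthonormal_iff_ite]
  intro i j
  rw [basisVec, basisVec, lp.inner_single_left]
  simp [Pi.single_apply]

theorem star_shift_mul_shift : star shift * shift = 1 := by
  ext1 x
  refine ext_inner_left ℂ fun y => ?_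
  change inner ℂ y (ContinuousLinearMap.adjoint shift (shift x)) = inner ℂ y x
  rw [ContinuousLinearMap.adjoint_inner_right]
  exact shiftIsometry.inner_map_map y x

theorem star_shift_basisVec_succ (k : ℕ) : star shift (basisVec (k + 1)) = basisVec k := by
  rw [← shift_basisVec]
  exact congrArg (fun T : ℓ²(ℕ, ℂ) →L[ℂ] ℓ²(ℕ, ℂ) => T (basisVec k)) star_shift_mul_shift

theorem star_shift_basisVec_zero : star shift (basisVec 0) = 0 := by
  refine ext_inner_right ℂ fun x => ?_
  change inner ℂ (ContinuousLinearMap.adjoint shift (basisVec 0)) x = inner ℂ 0 x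
  rw [ContinuousLinearMap.adjoint_inner_left, basisVec, lp.inner_single_left, inner_zero_left]
  change inner ℂ (1 : ℂ) (0 : ℂ) = 0
  exact inner_zero_right _

theorem star_shift_pow_basisVec (n k : ℕ) :
    (star shift ^ n) (basisVec k) = if n ≤ k then basisVec (k - n) else 0 := by
  induction n with
  | zero => simp
  | succ n ih =>
    rw [pow_succ', mul_apply_eq_comp, ih]
    by_cases h : n + 1 ≤ k
    · rw [if_pos (by omega), if_pos h]
      obtain ⟨m, rfl⟩ := Nat.exists_eq_add_of_le h
      rw [show n + 1 + m - n = m + 1 by omega, show n + 1 + m - (n + 1) = m by omega,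
        star_shift_basisVec_succ]
    · rw [if_neg h]
      by_cases h' : n ≤ k
      · rw [if_pos h', show k - n = 0 by omega, star_shift_basisVec_zero]
      · rw [if_neg h', map_zero]

theorem shift_pow_basisVec (n k : ℕ) : (shift ^ n) (basisVec k) = basisVec (k + n) := by
  induction n with
  | zero => simp
  | succ n ih => rw [pow_succ', mul_apply_eq_comp, ih, shift_basisVec, add_assoc]

theorem tendsto_star_shift_pow (x : ℓ²(ℕ, ℂ)) :
    Tendsto (fun n => (star shift ^ n) x) atTop (𝓝 0) := by
  rw [Metric.tendsto_atTop]
  intro ε hε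
  have hx := (lp.hasSum_single (p := 2) (by norm_num) x).tendsto_sum_nat
  obtain ⟨N, hN⟩ := Metric.tendsto_atTop.1 hx ε hε
  refine ⟨N, fun n hn => ?_⟩
  have h0 := hN N le_rfl
  set y := ∑ i ∈ Finset.range N, lp.single 2 i ((x : ℕ → ℂ) i)
  have hy : (star shift ^ n) y = 0 := by
    rw [map_sum]
    refine Finset.sum_eq_zero fun i hi => ?_
    have e : lp.single 2 i ((x : ℕ → ℂ) i) = ((x : ℕ → ℂ) i) • basisVec i := by
      rw [basisVec, ← lp.single_smul, smul_eq_mul, mul_one]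
    rw [e, map_smul, star_shift_pow_basisVec, if_neg, smul_zero]
    have := Finset.mem_range.1 hi
    omega
  rw [dist_zero_right]
  have e : (star shift ^ n) x = (star shift ^ n) (x - y) := by rw [map_sub, hy, sub_zero]
  rw [e]
  refine (norm_star_pow_le star_shift_mul_shift n _).trans_lt ?_
  rwa [← dist_eq_norm, dist_comm]

/-- A bounded sequence of operators converging strongly to zero converges in norm to zero after
multiplication by a compact operator. -/
theorem tendsto_norm_mul_compact {H : Type*} [NormedAddCommGroup H] [InnerProductSpace ℂ H]
    {T : ℕ → H →L[ℂ] H} (hT : ∀ n, ‖T n‖ ≤ 1) (hT0 : ∀ x, Tendsto (fun n => T n x) atTop (𝓝 0))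
    {k : H →L[ℂ] H} (hk : IsCompactOperator k) :
    Tendsto (fun n => ‖T n * k‖) atTop (𝓝 0) := by
  have hkt : TotallyBounded (k '' Metric.closedBall 0 1) :=
    (IsCompactOperator.isCompact_closure_image_closedBall
      (f := (k : H →ₗ[ℂ] H)) hk 1).totallyBounded.subset subset_closure
  rw [Metric.tendsto_atTop]
  intro ε hε
  obtain ⟨t, htf, htc⟩ := Metric.totallyBounded_iff.1 hkt (ε / 3) (by positivity)
  have hev : ∀ᶠ n in atTop, ∀ y ∈ t, ‖T n y‖ < ε / 3 := by
    rw [htf.eventually_all]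
    intro y _
    have := Metric.tendsto_nhds.1 (hT0 y) (ε / 3) (by positivity)
    simpa only [dist_zero_right] using this
  obtain ⟨N, hN⟩ := eventually_atTop.1 hev
  refine ⟨N, fun n hn => ?_⟩
  rw [dist_zero_right, norm_norm]
  refine lt_of_le_of_lt (ContinuousLinearMap.opNorm_le_of_unit_norm (C := ε / 3 + ε / 3)
    (by positivity) fun x hx => ?_) (by linarith)
  obtain ⟨y, hy, hxy⟩ := Set.mem_iUnion₂.1
    (htc ⟨x, by rw [mem_closedBall_zero_iff]; exact hx.le, rfl⟩)
  rw [Metric.mem_ball, dist_eq_norm] at hxy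
  have e : (T n * k) x = T n (k x - y) + T n y := by
    rw [← map_add, sub_add_cancel]; rfl
  rw [e]
  refine (norm_add_le _ _).trans (add_le_add ?_ (hN n hn y hy).le)
  exact ((T n).le_of_opNorm_le (hT n) _).trans (by rw [one_mul]; exact hxy.le)

/-- The finite-rank projections `1 - s^n s^{*n}` form an approximate unit for the compact
operators. -/
theorem tendsto_compact_mul_proj {k : ℓ²(ℕ, ℂ) →L[ℂ] ℓ²(ℕ, ℂ)} (hk : IsCompactOperator k) :
    Tendsto (fun n => k * (1 - shift ^ n * star shift ^ n)) atTop (𝓝 k) := by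
  have hn : ∀ n, ‖star shift ^ n‖ ≤ 1 := fun n => by
    simpa using norm_pow_mul_star_pow_le star_shift_mul_shift 0 n
  have h := tendsto_norm_mul_compact hn tendsto_star_shift_pow (isCompactOperator_star hk)
  rw [tendsto_iff_norm_sub_tendsto_zero]
  refine squeeze_zero (fun n => norm_nonneg _) (fun n => ?_) h
  have e : k * (1 - shift ^ n * star shift ^ n) - k =
      star (star shift ^ n * star k) * -(star shift ^ n) := by
    rw [star_mul, star_star, star_pow, star_star]
    noncomm_ring
  rw [e]
  refine (norm_mul_le _ _).trans ?_
  rw [norm_neg]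
  exact (mul_le_of_le_one_right (norm_nonneg _) (hn n)).trans
    (ContinuousLinearMap.adjoint.norm_map (star shift ^ n * star k)).le

theorem star_shift_apply (x : ℓ²(ℕ, ℂ)) (n : ℕ) :
    (star shift x : ℕ → ℂ) n = (x : ℕ → ℂ) (n + 1) := by
  have h : ∀ (y : ℓ²(ℕ, ℂ)) m, inner ℂ (basisVec m) y = (y : ℕ → ℂ) m := fun y m => by
    rw [basisVec, lp.inner_single_left]
    simp
  rw [← h, ← h, ← shift_basisVec]
  exact ContinuousLinearMap.adjoint_inner_right shift (basisVec n) x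

theorem isCompactOperator_defect_shift :
    IsCompactOperator (1 - shift * star shift : ℓ²(ℕ, ℂ) →L[ℂ] ℓ²(ℕ, ℂ)) := by
  have h : (1 - shift * star shift : ℓ²(ℕ, ℂ) →L[ℂ] ℓ²(ℕ, ℂ)) =
      (ContinuousLinearMap.toSpanSingleton ℂ (basisVec 0)) ∘L innerSL ℂ (basisVec 0) := by
    ext x n
    change (x : ℕ → ℂ) n - (shift (star shift x) : ℕ → ℂ) n =
      inner ℂ (basisVec 0) x * (basisVec 0 : ℕ → ℂ) n
    rw [basisVec, lp.inner_single_left]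
    cases n with
    | zero =>
      change (x : ℕ → ℂ) 0 - 0 = _
      simp
    | succ n =>
      change (x : ℕ → ℂ) (n + 1) - (star shift x : ℕ → ℂ) n = _
      rw [star_shift_apply]
      simp
  rw [h]
  exact (isCompactOperator_of_locallyCompactSpace_rng
    (ContinuousLinearMap.toSpanSingleton ℂ (basisVec 0))).comp_clm _

end ShiftOperator

/-! ### Closed subalgebras containing an isometry -/

section Transfer

variable {M N : Type*} [CStarAlgebra M] [CStarAlgebra N] {r : ℝ} {v : M}

theorem map_weightedShift (h0 : 0 < r) (h1 : r < 1) (hv : star v * v = 1) (φ : M →⋆ₐ[ℂ] N) :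
    φ (weightedShift r v) = weightedShift r (φ v) := by
  have hv' : star (φ v) * φ v = 1 := by rw [← map_star, ← map_mul, hv, map_one]
  refine HasSum.unique ?_ (hasSum_weightedShift h0 h1 hv')
  have := (hasSum_weightedShift h0 h1 hv).map φ
    (AddMonoidHomClass.continuous_of_bound φ 1 fun x => by
      rw [one_mul]; exact NonUnitalStarAlgHom.norm_apply_le φ x)
  simpa only [Function.comp_def, map_smul, map_mul, map_pow, map_star] using this

theorem weightedShift_mem (h0 : 0 < r) (h1 : r < 1) (hv : star v * v = 1) {S : StarSubalgebra ℂ M}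
    (hS : IsClosed (S : Set M)) (hvS : v ∈ S) : weightedShift r v ∈ S := by
  refine hS.mem_of_tendsto (hasSum_weightedShift h0 h1 hv).tendsto_sum_nat
    (Eventually.of_forall fun n => sum_mem fun i _ => ?_)
  exact SMulMemClass.smul_mem _ (mul_mem (pow_mem hvS _) (pow_mem (star_mem hvS) _))

theorem FreeStarAlgebra.map_mem {X : Type} (φ : FreeStarAlgebra X →⋆ₐ[ℂ] M)
    {S : StarSubalgebra ℂ M} (h : ∀ x, φ (FreeStarAlgebra.gen x) ∈ S) (y : FreeStarAlgebra X) :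
    φ y ∈ S := by
  induction y using FreeStarAlgebra.induction with
  | scalar c => rw [AlgHomClass.commutes]; exact algebraMap_mem S c
  | letter y =>
    cases y with
    | inl x => exact h x
    | inr x =>
      have e : FreeStarAlgebra.letter (Sum.inr x) = star (FreeStarAlgebra.gen x) :=
        (FreeStarAlgebra.star_letter (Sum.inl x)).symm
      rw [e, map_star]
      exact star_mem (h x)
  | mul a b ha hb => rw [map_mul]; exact mul_mem ha hb
  | add a b ha hb => rw [map_add]; exact add_mem ha hb

/-- The star subalgebra of all `x` for which both `x` and `star x` lie in a given subalgebra. -/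
def starCore (S : Subalgebra ℂ M) : StarSubalgebra ℂ M where
  carrier := {x | x ∈ S ∧ star x ∈ S}
  mul_mem' {x y} hx hy := ⟨mul_mem hx.1 hy.1, by rw [star_mul]; exact mul_mem hy.2 hx.2⟩
  add_mem' {x y} hx hy := ⟨add_mem hx.1 hy.1, by rw [star_add]; exact add_mem hx.2 hy.2⟩
  algebraMap_mem' c := ⟨algebraMap_mem S c, by
    rw [← algebraMap_star_comm]; exact algebraMap_mem S _⟩
  star_mem' {x} hx := ⟨hx.2, by rw [star_star]; exact hx.1⟩

theorem isClosed_starCore {S : Subalgebra ℂ M} (hS : IsClosed (S : Set M)) :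
    IsClosed (starCore S : Set M) :=
  hS.inter (hS.preimage continuous_star)

end Transfer

/-! ### The norm estimate modulo compact operators -/

section KeyEstimate

/-- The Hilbert space `ℓ²(ℕ) ⊗ ℓ²(ℕ)`. -/
abbrev GridSpace : Type := HilbertTensor ℓ²(ℕ, ℂ) ℓ²(ℕ, ℂ)

/-- The orthonormal family `e_i ⊗ e_j` in `ℓ²(ℕ) ⊗ ℓ²(ℕ)`. -/
def gridVec (k : ℕ × ℕ) : GridSpace := HilbertTensor.tmul (basisVec k.1) (basisVec k.2)

theorem orthonormal_gridVec : Orthonormal ℂ gridVec :=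
  HilbertTensor.orthonormal_tmul orthonormal_basisVec orthonormal_basisVec

variable {H : Type*} [NormedAddCommGroup H] [InnerProductSpace ℂ H] [CompleteSpace H]
  {V W : H →L[ℂ] H}

/-- The approximate embedding of `H` into a multiple of `ℓ²(ℕ) ⊗ ℓ²(ℕ)` attached to two
isometries on `H`. -/
def gridEmbed (V W : H →L[ℂ] H) (n : ℕ) : H →L[ℂ] HilbertTensor H GridSpace :=
  gridOp gridVec (windowOp V (n + 1)) (windowOp W (n + 1)) (n + 1) (n + 1)

theorem norm_gridEmbed_apply (hV : star V * V = 1) (hW : star W * W = 1) (n : ℕ) (h : H) :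
    ‖gridEmbed V W n h‖ = ‖h‖ := by
  have := norm_gridOp_sq orthonormal_gridVec (windowOp V (n + 1)) (windowOp W (n + 1))
    (n + 1) (n + 1) h
  simp only [sum_norm_windowOp_sq hV n.succ_pos, sum_norm_windowOp_sq hW n.succ_pos] at this
  exact (sq_eq_sq₀ (norm_nonneg _) (norm_nonneg _)).1 this

theorem norm_gridEmbed_le (hV : star V * V = 1) (hW : star W * W = 1) (n : ℕ) :
    ‖gridEmbed V W n‖ ≤ 1 :=
  ContinuousLinearMap.opNorm_le_bound _ zero_le_one fun h => by
    rw [norm_gridEmbed_apply hV hW, one_mul]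

theorem commute_windowOp (hVW : Commute V W) (hVW' : Commute (star V) W) (n i : ℕ) :
    Commute V (windowOp W n i) ∧ Commute (star V) (windowOp W n i) := by
  have c1 : Commute V (star W) := star_star_commute hVW'
  have c2 : Commute (star V) (star W) := hVW.star_star
  have key : ∀ T : H →L[ℂ] H, Commute T W → Commute T (star W) → Commute T (windowOp W n i) := by
    intro T h1 h2
    refine Commute.mul_right (Commute.add_right (Commute.smul_right ?_ _)
      (Commute.smul_right (h1.mul_right h2) _)) (h2.pow_right i)
    exact (Commute.one_right T).sub_right (h1.mul_right h2)
  exact ⟨key V hVW c1, key (star V) hVW' c2⟩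

theorem commute_windowOp_windowOp (hVW : Commute V W) (hVW' : Commute (star V) W) (n i m j : ℕ) :
    Commute (windowOp V n i) (windowOp W m j) := by
  obtain ⟨h1, h2⟩ := commute_windowOp hVW hVW' m j
  refine Commute.mul_left (Commute.add_left (Commute.smul_left ?_ _)
      (Commute.smul_left (h1.mul_left h2) _)) (h2.pow_left i)
  exact (Commute.one_left _).sub_left (h1.mul_left h2)

theorem tendsto_sqrt_three_div : Tendsto (fun n : ℕ => √(3 / ((n + 1 : ℕ) : ℝ))) atTop (𝓝 0) := by
  have h := (tendsto_const_div_atTop_nhds_zero_nat (3 : ℝ)).comp (tendsto_add_atTop_nat 1)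
  have := (Real.continuous_sqrt.tendsto 0).comp h
  rwa [Real.sqrt_zero] at this

theorem shift_tmul_mem (hV : star V * V = 1) (hW : star W * W = 1) (hVW : Commute V W)
    (hVW' : Commute (star V) W) :
    ((opTensor shift 1 : GridSpace →L[ℂ] GridSpace), V) ∈
      starCore (asympIntertwiners opTensorRight (gridEmbed V W)) := by
  have hS : star (opTensor shift 1 : GridSpace →L[ℂ] GridSpace) * opTensor shift 1 = 1 := by
    rw [star_opTensor, opTensor_mul, star_shift_mul_shift, star_one, one_mul, opTensor_one]
  have hSf : ∀ i j, (opTensor shift 1 : GridSpace →L[ℂ] GridSpace) (gridVec (i, j)) =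
      gridVec (i + 1, j) := fun i j => by
    rw [gridVec, opTensor_tmul, shift_basisVec]; rfl
  have hSf' : ∀ j, star (opTensor shift 1 : GridSpace →L[ℂ] GridSpace) (gridVec (0, j)) = 0 :=
    fun j => by
      rw [star_opTensor, gridVec, opTensor_tmul, star_shift_basisVec_zero, HilbertTensor.tmul,
        TensorProduct.zero_tmul, map_zero]
  have hY : ∀ (n : ℕ) h, ∑ j ∈ Finset.range (n + 1), ‖windowOp W (n + 1) j h‖ ^ 2 ≤ ‖h‖ ^ 2 :=
    fun n h => (sum_norm_windowOp_sq hW n.succ_pos h).le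
  refine ⟨?_, ?_⟩
  · refine squeeze_zero (fun n => norm_nonneg _) (fun n => ?_) tendsto_sqrt_three_div
    exact norm_gridOp_mul_sub_le orthonormal_gridVec hV hSf
      (fun j => (commute_windowOp hVW hVW' _ j).1.symm) n.succ_pos (hY n)
  · refine squeeze_zero (fun n => norm_nonneg _) (fun n => ?_) tendsto_sqrt_three_div
    exact norm_gridOp_mul_star_sub_le orthonormal_gridVec hV hS hSf hSf'
      (fun j => (commute_windowOp hVW hVW' _ j).1.symm)
      (fun j => (commute_windowOp hVW hVW' _ j).2.symm) n.succ_pos (hY n)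

theorem tmul_shift_mem (hV : star V * V = 1) (hW : star W * W = 1) (hVW : Commute V W)
    (hVW' : Commute (star V) W) :
    ((opTensor 1 shift : GridSpace →L[ℂ] GridSpace), W) ∈
      starCore (asympIntertwiners opTensorRight (gridEmbed V W)) := by
  have hS : star (opTensor 1 shift : GridSpace →L[ℂ] GridSpace) * opTensor 1 shift = 1 := by
    rw [star_opTensor, opTensor_mul, star_shift_mul_shift, star_one, one_mul, opTensor_one]
  have hSf : ∀ i j, (opTensor 1 shift : GridSpace →L[ℂ] GridSpace)
      ((gridVec ∘ Prod.swap) (i, j)) = (gridVec ∘ Prod.swap) (i + 1, j) := fun i j => by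
    simp only [Function.comp_apply, Prod.swap_prod_mk, gridVec]
    rw [opTensor_tmul, shift_basisVec]; rfl
  have hSf' : ∀ j, star (opTensor 1 shift : GridSpace →L[ℂ] GridSpace)
      ((gridVec ∘ Prod.swap) (0, j)) = 0 := fun j => by
    simp only [Function.comp_apply, Prod.swap_prod_mk, gridVec]
    rw [star_opTensor, opTensor_tmul, star_shift_basisVec_zero, HilbertTensor.tmul_zero]
  have hf : Orthonormal ℂ (gridVec ∘ Prod.swap) :=
    orthonormal_gridVec.comp _ Prod.swap_injective
  have hY : ∀ (n : ℕ) h, ∑ j ∈ Finset.range (n + 1), ‖windowOp V (n + 1) j h‖ ^ 2 ≤ ‖h‖ ^ 2 :=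
    fun n h => (sum_norm_windowOp_sq hV n.succ_pos h).le
  have hWV' : Commute (star W) V := (star_star_commute hVW').symm
  have hswap : ∀ n, gridEmbed V W n = gridOp (gridVec ∘ Prod.swap) (windowOp W (n + 1))
      (windowOp V (n + 1)) (n + 1) (n + 1) := fun n =>
    (gridOp_swap (fun i j => commute_windowOp_windowOp hVW hVW' _ i _ j) _ _).symm
  refine ⟨?_, ?_⟩
  · refine squeeze_zero (fun n => norm_nonneg _) (fun n => ?_) tendsto_sqrt_three_div
    rw [hswap]
    exact norm_gridOp_mul_sub_le hf hW hSf
      (fun j => (commute_windowOp hVW.symm hWV' _ j).1.symm) n.succ_pos (hY n)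
  · refine squeeze_zero (fun n => norm_nonneg _) (fun n => ?_) tendsto_sqrt_three_div
    rw [hswap]
    exact norm_gridOp_mul_star_sub_le hf hW hS hSf hSf'
      (fun j => (commute_windowOp hVW.symm hWV' _ j).1.symm)
      (fun j => (commute_windowOp hVW.symm hWV' _ j).2.symm) n.succ_pos (hY n)

theorem isClosed_gridIntertwiners (hV : star V * V = 1) (hW : star W * W = 1) :
    IsClosed (asympIntertwiners opTensorRight (gridEmbed V W) :
      Set ((GridSpace →L[ℂ] GridSpace) × (H →L[ℂ] H))) :=
  isClosed_asympIntertwiners (norm_gridEmbed_le hV hW)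

/-- If the defects of `V` and `W` are orthogonal, then `(1 ⊗ R) ∘ gridEmbed V W n` tends to zero in
norm for every `R` in `K ⊗ K`: for the projections `(1 - sᵐ s^*ᵐ) ⊗ (1 - sᵐ s^*ᵐ)` the corresponding
operator on `H` vanishes, and these projections form an approximate unit of `K ⊗ K`. -/
theorem compactTensor_mem (hV : star V * V = 1) (hW : star W * W = 1) (hVW : Commute V W)
    (hVW' : Commute (star V) W) (h : (1 - V * star V) * (1 - W * star W) = 0)
    {R : GridSpace →L[ℂ] GridSpace} (hR : R ∈ compactTensor ℓ²(ℕ, ℂ) ℓ²(ℕ, ℂ)) :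
    (R, (0 : H →L[ℂ] H)) ∈ asympIntertwiners opTensorRight (gridEmbed V W) := by
  have hcl := isClosed_gridIntertwiners hV hW
  refine compactTensor_induction (p := fun R => (R, (0 : H →L[ℂ] H)) ∈
    asympIntertwiners opTensorRight (gridEmbed V W)) ?_ ?_ ?_ ?_ ?_ R hR
  · exact hcl.preimage (by fun_prop : Continuous fun R : GridSpace →L[ℂ] GridSpace =>
      (R, (0 : H →L[ℂ] H)))
  · exact zero_mem _
  · intro P Q hP hQ
    have := add_mem hP hQ
    rwa [Prod.mk_add_mk, add_zero] at this
  · intro c P hP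
    have := SMulMemClass.smul_mem c hP
    rwa [Prod.smul_mk, smul_zero] at this
  · intro k l hk hl
    have hm := shift_tmul_mem hV hW hVW hVW'
    have hm' := tmul_shift_mem hV hW hVW hVW'
    have hproj : ∀ n, (opTensor (1 - shift ^ n * star shift ^ n) (1 - shift ^ n * star shift ^ n),
        (0 : H →L[ℂ] H)) ∈ asympIntertwiners opTensorRight (gridEmbed V W) := by
      intro n
      have h1 := sub_mem (one_mem _) (mul_mem (pow_mem hm n) (pow_mem (star_mem hm) n))
      have h2 := sub_mem (one_mem _) (mul_mem (pow_mem hm' n) (pow_mem (star_mem hm') n))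
      have h3 := (mul_mem h1 h2).1
      convert h3 using 1
      refine Prod.ext ?_ ?_
      · change opTensor (1 - shift ^ n * star shift ^ n) (1 - shift ^ n * star shift ^ n) =
          (1 - opTensorLeft shift ^ n * star (opTensorLeft shift) ^ n) *
            (1 - opTensorRight shift ^ n * star (opTensorRight shift) ^ n)
        rw [opTensor_eq_mul]
        simp only [map_sub, map_one, map_mul, map_pow, map_star]
      · exact (defect_pow_mul_defect_pow hVW hVW' h n n).symm
    have hlim : Tendsto (fun n => opTensor (k * (1 - shift ^ n * star shift ^ n))
        (l * (1 - shift ^ n * star shift ^ n))) atTop (𝓝 (opTensor k l)) := by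
      simp only [opTensor_eq_mul]
      exact ((continuous_opTensorLeft.tendsto k).comp (tendsto_compact_mul_proj hk)).mul
        ((continuous_opTensorRight.tendsto l).comp (tendsto_compact_mul_proj hl))
    refine hcl.mem_of_tendsto (hlim.prodMk_nhds tendsto_const_nhds)
      (Eventually.of_forall fun n => ?_)
    rw [← opTensor_mul]
    exact mul_mem_asympIntertwiners _ (hproj n)

/-- The norm of a `*`-polynomial in a solution of the sphere relations is bounded by the norm,
modulo compact operators, of the same polynomial in the weighted shifts. -/
theorem norm_le_norm_add_compact {p q : Set.Ioo (0 : ℝ) 1}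
    (φ : FreeStarAlgebra SphereGen →⋆ₐ[ℂ] (GridSpace →L[ℂ] GridSpace))
    (ψ : FreeStarAlgebra SphereGen →⋆ₐ[ℂ] (H →L[ℂ] H))
    (hφa : φ (.gen .a) = opTensor (weightedShift q shift) 1)
    (hφb : φ (.gen .b) = opTensor 1 (weightedShift p shift))
    (hψ : ∀ x y, SphereRel p q x y → ψ x = ψ y)
    (x : FreeStarAlgebra SphereGen) {R : GridSpace →L[ℂ] GridSpace}
    (hR : R ∈ compactTensor ℓ²(ℕ, ℂ) ℓ²(ℕ, ℂ)) : ‖ψ x‖ ≤ ‖φ x + R‖ := by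
  have ha := hψ _ _ SphereRel.disc_a
  have hb := hψ _ _ SphereRel.disc_b
  have hab := hψ _ _ SphereRel.comm
  have hab' := hψ _ _ SphereRel.star_comm
  have h := hψ _ _ SphereRel.sphere
  simp only [map_sub, map_mul, map_smul, map_one, map_star, map_zero] at ha hb hab hab' h
  obtain ⟨V, W, hV, hW, hVW, hVW', hd, hVa, hWb⟩ :=
    exists_isometries_of_sphere q.2.1 q.2.2 p.2.1 p.2.2 ha hb hab hab' h
  have hm := shift_tmul_mem hV hW hVW hVW'
  have hm' := tmul_shift_mem hV hW hVW hVW'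
  have hcl := isClosed_starCore (isClosed_gridIntertwiners hV hW)
  let S := starCore (asympIntertwiners opTensorRight (gridEmbed V W))
  have hmem : (φ x, ψ x) ∈ S := by
    refine FreeStarAlgebra.map_mem (φ.prod ψ) (S := S) (fun y => ?_) x
    change (φ (.gen y), ψ (.gen y)) ∈ S
    cases y with
    | a =>
      have hv : star ((opTensor shift 1 : GridSpace →L[ℂ] GridSpace), V) *
          ((opTensor shift 1 : GridSpace →L[ℂ] GridSpace), V) = 1 :=
        Prod.ext (by
          change star (opTensor shift 1) * opTensor shift 1 = 1
          rw [star_opTensor, opTensor_mul, star_shift_mul_shift, star_one, one_mul,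
            opTensor_one]) hV
      have := weightedShift_mem q.2.1 q.2.2 hv hcl hm
      convert this using 1
      refine Prod.ext ?_ ?_
      · have e := map_weightedShift q.2.1 q.2.2 hv (StarAlgHom.fst ℂ _ _)
        have e' := map_weightedShift q.2.1 q.2.2 star_shift_mul_shift
          (opTensorLeft (H := ℓ²(ℕ, ℂ)) (K := ℓ²(ℕ, ℂ)))
        exact hφa.trans (e'.trans e.symm)
      · have e := map_weightedShift q.2.1 q.2.2 hv (StarAlgHom.snd ℂ _ _)
        exact hVa.symm.trans e.symm
    | b =>
      have hv : star ((opTensor 1 shift : GridSpace →L[ℂ] GridSpace), W) *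
          ((opTensor 1 shift : GridSpace →L[ℂ] GridSpace), W) = 1 :=
        Prod.ext (by
          change star (opTensor 1 shift) * opTensor 1 shift = 1
          rw [star_opTensor, opTensor_mul, star_shift_mul_shift, star_one, one_mul,
            opTensor_one]) hW
      have := weightedShift_mem p.2.1 p.2.2 hv hcl hm'
      convert this using 1
      refine Prod.ext ?_ ?_
      · have e := map_weightedShift p.2.1 p.2.2 hv (StarAlgHom.fst ℂ _ _)
        have e' := map_weightedShift p.2.1 p.2.2 star_shift_mul_shift
          (opTensorRight (H := ℓ²(ℕ, ℂ)) (K := ℓ²(ℕ, ℂ)))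
        exact hφb.trans (e'.trans e.symm)
      · have e := map_weightedShift p.2.1 p.2.2 hv (StarAlgHom.snd ℂ _ _)
        exact hWb.symm.trans e.symm
  have := add_mem hmem.1 (compactTensor_mem hV hW hVW hVW' hd hR)
  rw [Prod.mk_add_mk, add_zero] at this
  exact norm_le_of_mem_asympIntertwiners (norm_gridEmbed_apply hV hW) this

end KeyEstimate

/-! ### Isomorphisms from equality of seminorms -/

section Extension

/-- Two representations of a `*`-algebra which induce the same seminorm generate isomorphic
`C*`-algebras. The isomorphism is the closure of the graph of the correspondence `β x ↦ γ x`. -/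
theorem exists_starAlgEquiv_of_norm_eq {P B C : Type*} [Ring P] [StarRing P] [Algebra ℂ P]
    [CStarAlgebra B] [CStarAlgebra C] (β : P →⋆ₐ[ℂ] B) (γ : P →⋆ₐ[ℂ] C)
    (h : ∀ x, ‖β x‖ = ‖γ x‖) (hγ : DenseRange γ) :
    ∃ φ : β.range.topologicalClosure ≃⋆ₐ[ℂ] C,
      ∀ x (hx : β x ∈ β.range.topologicalClosure), φ ⟨β x, hx⟩ = γ x := by
  let S := (β.prod γ).range.topologicalClosure
  have hScl : IsClosed (S : Set (B × C)) := StarSubalgebra.isClosed_topologicalClosure _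
  have : CompleteSpace S := hScl.completeSpace_coe
  have hmem : ∀ x, (β x, γ x) ∈ S := fun x => StarSubalgebra.le_topologicalClosure _ ⟨x, rfl⟩
  have hn : ∀ g ∈ S, ‖g.1‖ = ‖g.2‖ := fun g hg => by
    refine closure_minimal (t := {g : B × C | ‖g.1‖ = ‖g.2‖}) ?_
      (isClosed_eq (by fun_prop) (by fun_prop)) hg
    rintro _ ⟨x, rfl⟩
    exact h x
  have hn1 : ∀ g : S, ‖g.1.1‖ = ‖g‖ := fun g => by
    change _ = max ‖g.1.1‖ ‖g.1.2‖
    rw [← hn g.1 g.2, max_self]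
  have hn2 : ∀ g : S, ‖g.1.2‖ = ‖g‖ := fun g => by rw [← hn g.1 g.2, hn1]
  let f1 : S →⋆ₐ[ℂ] B := (StarAlgHom.fst ℂ B C).comp S.subtype
  let f2 : S →⋆ₐ[ℂ] C := (StarAlgHom.snd ℂ B C).comp S.subtype
  have i1 : Isometry f1 := AddMonoidHomClass.isometry_of_norm f1 hn1
  have i2 : Isometry f2 := AddMonoidHomClass.isometry_of_norm f2 hn2
  have c1 : ∀ g, f1 g ∈ β.range.topologicalClosure := fun g => by
    refine closure_minimal (t := {g : B × C | g.1 ∈ β.range.topologicalClosure}) ?_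
      ((StarSubalgebra.isClosed_topologicalClosure _).preimage continuous_fst) g.2
    rintro _ ⟨x, rfl⟩
    exact StarSubalgebra.le_topologicalClosure _ ⟨x, rfl⟩
  have s1 : ∀ y ∈ β.range.topologicalClosure, ∃ g, f1 g = y := fun y hy => by
    refine closure_minimal (t := Set.range f1) ?_ i1.isClosedEmbedding.isClosed_range hy
    rintro _ ⟨x, rfl⟩
    exact ⟨⟨_, hmem x⟩, rfl⟩
  have s2 : Function.Surjective f2 := fun y => by
    have hy : y ∈ closure (Set.range γ) := hγ y
    refine closure_minimal (t := Set.range f2) ?_ i2.isClosedEmbedding.isClosed_range hy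
    rintro _ ⟨x, rfl⟩
    exact ⟨⟨_, hmem x⟩, rfl⟩
  let e1 : S ≃⋆ₐ[ℂ] β.range.topologicalClosure :=
    StarAlgEquiv.ofBijective (f1.codRestrict _ c1)
      ⟨fun x y hxy => i1.injective (congrArg Subtype.val hxy), fun y => by
        obtain ⟨g, hg⟩ := s1 y.1 y.2
        exact ⟨g, Subtype.ext hg⟩⟩
  let e2 : S ≃⋆ₐ[ℂ] C := StarAlgEquiv.ofBijective f2 ⟨i2.injective, s2⟩
  refine ⟨e1.symm.trans e2, fun x hx => ?_⟩
  have : e1.symm ⟨β x, hx⟩ = ⟨_, hmem x⟩ := by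
    rw [StarAlgEquiv.symm_apply_eq]
    exact Subtype.ext rfl
  rw [StarAlgEquiv.trans_apply, this]
  rfl

theorem FreeStarAlgebra.hom_ext {X : Type} {A : Type*} [Ring A] [StarRing A] [Algebra ℂ A]
    {φ ψ : FreeStarAlgebra X →⋆ₐ[ℂ] A}
    (h : ∀ x, φ (FreeStarAlgebra.gen x) = ψ (FreeStarAlgebra.gen x)) (y : FreeStarAlgebra X) :
    φ y = ψ y := by
  induction y using FreeStarAlgebra.induction with
  | scalar c => rw [AlgHomClass.commutes, AlgHomClass.commutes]
  | letter y =>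
    cases y with
    | inl x => exact h x
    | inr x =>
      have e : FreeStarAlgebra.letter (Sum.inr x) = star (FreeStarAlgebra.gen x) :=
        (FreeStarAlgebra.star_letter (Sum.inl x)).symm
      rw [e, map_star, map_star, h]
  | mul a b ha hb => rw [map_mul, map_mul, ha, hb]
  | add a b ha hb => rw [map_add, map_add, ha, hb]

/-- The quotient map from the free `*`-algebra as a `*`-homomorphism. -/
def UniversalStarAlgebra.mkStar {X : Type} (r : FreeStarAlgebra X → FreeStarAlgebra X → Prop) :
    FreeStarAlgebra X →⋆ₐ[ℂ] UniversalStarAlgebra r :=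
  { UniversalStarAlgebra.mk r with map_star' := fun _ => rfl }

end Extension

/-! ### Representations of the coordinate algebra -/

section SphereHom

variable {p q : Set.Ioo (0 : ℝ) 1}

/-- Doubly commuting isometries with orthogonal defects give a representation of `O(S³_pq)`. -/
theorem exists_sphere_hom {Q : Type*} [CStarAlgebra Q] {v w : Q} (hv : star v * v = 1)
    (hw : star w * w = 1) (hvw : Commute v w) (hvw' : Commute (star v) w)
    (h : (1 - v * star v) * (1 - w * star w) = 0) :
    ∃ Φ : SpherePoly p q →⋆ₐ[ℂ] Q, Φ (UniversalStarAlgebra.gen _ .a) = weightedShift q v ∧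
      Φ (UniversalStarAlgebra.gen _ .b) = weightedShift p w := by
  have hclosed : ∀ x : Q, IsClosed (StarAlgebra.elemental ℂ x : Set Q) :=
    fun x => StarAlgebra.elemental.isClosed ℂ x
  have ha : weightedShift q v ∈ StarAlgebra.elemental ℂ v :=
    weightedShift_mem q.2.1 q.2.2 hv (hclosed v) (StarAlgebra.elemental.self_mem ℂ v)
  have hb : weightedShift p w ∈ StarAlgebra.elemental ℂ w :=
    weightedShift_mem p.2.1 p.2.2 hw (hclosed w) (StarAlgebra.elemental.self_mem ℂ w)
  have c1 : Commute v (weightedShift p w) :=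
    commute_of_mem_elemental hvw (star_star_commute hvw') hb
  have c2 : Commute (star v) (weightedShift p w) :=
    commute_of_mem_elemental hvw' hvw.star_star hb
  have c3 : Commute (weightedShift q v) (weightedShift p w) :=
    (commute_of_mem_elemental c1.symm c2.symm ha).symm
  have c4 : Commute (star (weightedShift q v)) (weightedShift p w) :=
    (commute_of_mem_elemental c1.symm c2.symm (star_mem ha)).symm
  let f : SphereGen → Q
    | .a => weightedShift q v
    | .b => weightedShift p w
  obtain ⟨Φ, hΦ⟩ := UniversalStarAlgebra.exists_lift (SphereRel p q) f (by
    intro x y hxy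
    cases hxy <;>
      simp only [map_sub, map_mul, map_smul, map_one, map_star, map_zero,
        FreeStarAlgebra.eval_gen]
    · exact weightedShift_disc q.2.1 q.2.2 hv
    · exact weightedShift_disc p.2.1 p.2.2 hw
    · exact c3.eq
    · exact c4.eq
    · exact weightedShift_sphere q.2.1 q.2.2 p.2.1 p.2.2 hv hw hvw hvw' h)
  exact ⟨Φ, hΦ .a, hΦ .b⟩

end SphereHom

/-! ### Generators of the tensor square of the Toeplitz algebra -/

section ToeplitzTensorAlgebra

variable {p q : Set.Ioo (0 : ℝ) 1}

/-- The Toeplitz tensor product is generated by `w_q ⊗ 1` and `1 ⊗ w_p`. -/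
theorem toeplitzTensor_le {D : StarSubalgebra ℂ (GridSpace →L[ℂ] GridSpace)}
    (hD : IsClosed (D : Set (GridSpace →L[ℂ] GridSpace)))
    (ha : opTensorLeft (weightedShift q shift) ∈ D)
    (hb : opTensorRight (weightedShift p shift) ∈ D) : ToeplitzTensor ≤ D := by
  have key : ∀ (r : Set.Ioo (0 : ℝ) 1)
      (φ : (ℓ²(ℕ, ℂ) →L[ℂ] ℓ²(ℕ, ℂ)) →⋆ₐ[ℂ] (GridSpace →L[ℂ] GridSpace)), Continuous φ →
      φ (weightedShift r shift) ∈ D → ∀ x ∈ Toeplitz, φ x ∈ D := by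
    intro r φ hφ h
    have hs : shift ∈ D.comap φ := by
      have := mem_elemental_weightedShift r.2.1 r.2.2 (v := φ shift)
        (by rw [← map_star, ← map_mul, star_shift_mul_shift, map_one])
      rw [← map_weightedShift r.2.1 r.2.2 star_shift_mul_shift] at this
      exact StarAlgebra.elemental.le_of_mem hD h this
    exact fun x hx => StarAlgebra.elemental.le_of_mem (S := D.comap φ) (hD.preimage hφ) hs hx
  refine StarSubalgebra.topologicalClosure_minimal ?_ hD
  refine StarAlgebra.adjoin_le ?_
  rintro _ ⟨S, hS, T, hT, rfl⟩
  rw [opTensor_eq_mul]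
  exact mul_mem (key q _ continuous_opTensorLeft ha S hS) (key p _ continuous_opTensorRight hb T hT)

/-- The generators `s ⊗ 1` and `1 ⊗ s` of `T ⊗ T`. -/
def shiftGen : SphereGen → ToeplitzTensor
  | .a => Toeplitz.tmul Toeplitz.s 1
  | .b => Toeplitz.tmul 1 Toeplitz.s

theorem star_shiftGen_mul (x : SphereGen) : star (shiftGen x) * shiftGen x = 1 := by
  refine Subtype.ext ?_
  cases x
  · change star (opTensor shift 1) * opTensor shift 1 = 1
    rw [star_opTensor, opTensor_mul, star_shift_mul_shift, star_one, one_mul, opTensor_one]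
  · change star (opTensor 1 shift) * opTensor 1 shift = 1
    rw [star_opTensor, opTensor_mul, star_shift_mul_shift, star_one, one_mul, opTensor_one]

theorem commute_shiftGen : Commute (shiftGen .a) (shiftGen .b) := by
  refine Subtype.ext ?_
  change opTensor shift 1 * opTensor 1 shift = opTensor 1 shift * opTensor shift 1
  simp only [opTensor_mul, one_mul, mul_one]

theorem commute_star_shiftGen : Commute (star (shiftGen .a)) (shiftGen .b) := by
  refine Subtype.ext ?_
  change star (opTensor shift 1) * opTensor 1 shift = opTensor 1 shift * star (opTensor shift 1)
  simp only [star_opTensor, opTensor_mul, star_one, one_mul, mul_one]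

theorem shiftGen_defect_mem :
    ((1 - shiftGen .a * star (shiftGen .a)) * (1 - shiftGen .b * star (shiftGen .b)) :
      ToeplitzTensor).1 ∈ compactTensor ℓ²(ℕ, ℂ) ℓ²(ℕ, ℂ) := by
  have h := opTensor_mem_compactTensor isCompactOperator_defect_shift
    isCompactOperator_defect_shift
  rw [opTensor_eq_mul] at h
  simp only [map_sub, map_one, map_mul, map_star] at h
  exact h

/-- The image of a generator under `a ↦ w_q ⊗ 1`, `b ↦ 1 ⊗ w_p`. -/
def weightedGen (p q : Set.Ioo (0 : ℝ) 1) : SphereGen → ToeplitzTensor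
  | .a => weightedShift q (shiftGen .a)
  | .b => weightedShift p (shiftGen .b)

theorem coe_weightedGen_a :
    (weightedGen p q .a).1 = opTensorLeft (weightedShift q shift) :=
  (map_weightedShift q.2.1 q.2.2 (star_shiftGen_mul .a) ToeplitzTensor.subtype).trans
    (map_weightedShift q.2.1 q.2.2 star_shift_mul_shift opTensorLeft).symm

theorem coe_weightedGen_b :
    (weightedGen p q .b).1 = opTensorRight (weightedShift p shift) :=
  (map_weightedShift p.2.1 p.2.2 (star_shiftGen_mul .b) ToeplitzTensor.subtype).trans
    (map_weightedShift p.2.1 p.2.2 star_shift_mul_shift opTensorRight).symm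

end ToeplitzTensorAlgebra

/-! ### Comparison of the two norms -/

section Comparison

variable {p q : Set.Ioo (0 : ℝ) 1} {Q : Type} [CStarAlgebra Q] {m : ToeplitzTensor →⋆ₐ[ℂ] Q}

theorem exists_sphere_hom_of_quotient
    (hm : ∀ x : ToeplitzTensor, x.1 ∈ compactTensor ℓ²(ℕ, ℂ) ℓ²(ℕ, ℂ) → m x = 0) :
    ∃ Φ : SpherePoly p q →⋆ₐ[ℂ] Q,
      ∀ x, Φ (UniversalStarAlgebra.gen _ x) = m (weightedGen p q x) := by
  have hiso : ∀ x, star (m (shiftGen x)) * m (shiftGen x) = 1 := fun x => by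
    rw [← map_star, ← map_mul, star_shiftGen_mul, map_one]
  have hd : (1 - m (shiftGen .a) * star (m (shiftGen .a))) *
      (1 - m (shiftGen .b) * star (m (shiftGen .b))) = 0 := by
    have := hm _ shiftGen_defect_mem
    simpa only [map_mul, map_sub, map_one, map_star] using this
  obtain ⟨Φ, ha, hb⟩ := exists_sphere_hom (p := p) (q := q) (hiso .a) (hiso .b)
    (commute_shiftGen.map m) (by rw [← map_star]; exact commute_star_shiftGen.map m) hd
  refine ⟨Φ, fun x => ?_⟩
  cases x
  · exact ha.trans (map_weightedShift q.2.1 q.2.2 (star_shiftGen_mul .a) m).symm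
  · exact hb.trans (map_weightedShift p.2.1 p.2.2 (star_shiftGen_mul .b) m).symm

variable {Φ : SpherePoly p q →⋆ₐ[ℂ] Q}
  (hΦ : ∀ x, Φ (UniversalStarAlgebra.gen _ x) = m (weightedGen p q x))
include hΦ

theorem norm_rep_le (hn : ∀ (x : ToeplitzTensor) (ε : ℝ), 0 < ε →
      ∃ R ∈ compactTensor ℓ²(ℕ, ℂ) ℓ²(ℕ, ℂ), ‖x.1 + R‖ < ‖m x‖ + ε)
    (π : SphereRep p q) (x : SpherePoly p q) : ‖π.rep x‖ ≤ ‖Φ x‖ := by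
  obtain ⟨x, rfl⟩ := UniversalStarAlgebra.mk_surjective _ x
  let e : FreeStarAlgebra SphereGen →⋆ₐ[ℂ] ToeplitzTensor :=
    FreeStarAlgebra.eval (weightedGen p q)
  have he : m (e x) = Φ (UniversalStarAlgebra.mk _ x) :=
    FreeStarAlgebra.hom_ext (φ := m.comp e) (ψ := Φ.comp (UniversalStarAlgebra.mkStar _))
      (fun y => (congrArg m (FreeStarAlgebra.eval_gen _ y)).trans (hΦ y).symm) x
  refine le_of_forall_pos_le_add fun ε hε => ?_
  obtain ⟨R, hR, hRn⟩ := hn (e x) ε hε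
  rw [he] at hRn
  refine le_trans ?_ hRn.le
  refine norm_le_norm_add_compact (p := p) (q := q) (ToeplitzTensor.subtype.comp e)
    (π.rep.comp (UniversalStarAlgebra.mkStar _)) ?_ ?_ (fun y z h => ?_) x hR
  · exact (congrArg Subtype.val (FreeStarAlgebra.eval_gen (weightedGen p q) .a)).trans
      coe_weightedGen_a
  · exact (congrArg Subtype.val (FreeStarAlgebra.eval_gen (weightedGen p q) .b)).trans
      coe_weightedGen_b
  · exact congrArg π.rep (UniversalStarAlgebra.mk_eq _ h)

omit hΦ in
theorem norm_le_norm_univRep (Φ : SpherePoly p q →⋆ₐ[ℂ] Q) (x : SpherePoly p q) :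
    ‖Φ x‖ ≤ ‖SpherePoly.univRep p q x‖ := by
  rcases eq_or_ne (Φ x) 0 with h0 | h0
  · rw [h0, norm_zero]
    exact norm_nonneg _
  · obtain ⟨H, i1, i2, i3, i4, π, hπ⟩ := exists_rep_norm_le h0
    exact hπ.trans (lp.norm_apply_le_norm ENNReal.top_ne_zero (SpherePoly.univRep p q x)
      { H := H, rep := π.comp Φ })

theorem denseRange_sphere_hom (hm : Function.Surjective m) : DenseRange Φ := by
  let D := Φ.range.topologicalClosure
  have hgen : ∀ x, m (weightedGen p q x) ∈ D := fun x =>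
    StarSubalgebra.le_topologicalClosure _ ⟨_, hΦ x⟩
  have hmc : Continuous m := AddMonoidHomClass.continuous_of_bound m 1 fun x => by
    rw [one_mul]; exact NonUnitalStarAlgHom.norm_apply_le m x
  have hD : IsClosed (D.comap m : Set ToeplitzTensor) :=
    (StarSubalgebra.isClosed_topologicalClosure _).preimage hmc
  have hcl : Topology.IsClosedEmbedding
      (Subtype.val : ToeplitzTensor → GridSpace →L[ℂ] GridSpace) :=
    (isClosed_spatialTensor Toeplitz Toeplitz).isClosedEmbedding_subtypeVal
  have hle : ToeplitzTensor ≤ (D.comap m).map ToeplitzTensor.subtype :=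
    toeplitzTensor_le (p := p) (q := q) (hcl.isClosedMap _ hD)
      ⟨weightedGen p q .a, hgen .a, coe_weightedGen_a (p := p)⟩
      ⟨weightedGen p q .b, hgen .b, coe_weightedGen_b (q := q)⟩
  intro y
  obtain ⟨x, rfl⟩ := hm y
  obtain ⟨z, hz, hzx⟩ := hle x.2
  have : z = x := Subtype.ext hzx
  exact this ▸ hz

end Comparison

/-! ### The quotient by the compact operators -/

section Quotient

theorem ToeplitzQuotient.mk_eq_zero {x : ToeplitzTensor}
    (hx : x.1 ∈ compactTensor ℓ²(ℕ, ℂ) ℓ²(ℕ, ℂ)) : ToeplitzQuotient.mk x = 0 :=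
  Ideal.Quotient.eq_zero_iff_mem.2 hx

theorem ToeplitzQuotient.mk_surjective : Function.Surjective ToeplitzQuotient.mk :=
  Ideal.Quotient.mk_surjective

theorem ToeplitzQuotient.exists_norm_add_lt (x : ToeplitzTensor) {ε : ℝ} (hε : 0 < ε) :
    ∃ R ∈ compactTensor ℓ²(ℕ, ℂ) ℓ²(ℕ, ℂ), ‖x.1 + R‖ < ‖ToeplitzQuotient.mk x‖ + ε := by
  obtain ⟨y, hy, hyn⟩ := Submodule.Quotient.norm_mk_lt
    (S := compactIdeal Toeplitz Toeplitz) (Submodule.Quotient.mk x) hε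
  have hyx : y - x ∈ compactIdeal Toeplitz Toeplitz :=
    (Submodule.Quotient.eq _).1 hy
  refine ⟨(y - x).1, hyx, ?_⟩
  have : x.1 + (y - x).1 = y.1 := add_sub_cancel x.1 y.1
  rw [this]
  exact hyn

variable (r : Set.Ioo (0 : ℝ) 1)

/-- The weighted shift `w_r` as an element of the Toeplitz algebra. -/
def Toeplitz.weighted : Toeplitz :=
  ⟨weightedShift r shift, weightedShift_mem r.2.1 r.2.2 star_shift_mul_shift
    (StarAlgebra.elemental.isClosed ℂ shift) (StarAlgebra.elemental.self_mem ℂ shift)⟩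

theorem Toeplitz.hasSum_weighted :
    HasSum (fun n : ℕ => ((√(1 - (r : ℝ) ^ (n + 1)) - √(1 - (r : ℝ) ^ n) : ℝ) : ℂ) •
        (Toeplitz.s ^ (n + 1) * star Toeplitz.s ^ n)) (Toeplitz.weighted r) :=
  (Topology.IsInducing.subtypeVal.hasSum_iff (g := Toeplitz.subtype) _ _).1
    (hasSum_weightedShift r.2.1 r.2.2 star_shift_mul_shift)

theorem weightedShift_shift_single (k : ℕ) :
    weightedShift (r : ℝ) shift (lp.single 2 k 1) =
      ((√(1 - (r : ℝ) ^ (k + 1)) : ℝ) : ℂ) • lp.single 2 (k + 1) (1 : ℂ) := by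
  have h := (hasSum_weightedShift r.2.1 r.2.2 star_shift_mul_shift).mapL
    (ContinuousLinearMap.apply ℂ ℓ²(ℕ, ℂ) (basisVec k))
  refine h.unique ?_
  rw [← sum_range_shiftWeight, Complex.ofReal_sum, Finset.sum_smul]
  have hterm : ∀ n, ContinuousLinearMap.apply ℂ ℓ²(ℕ, ℂ) (basisVec k)
      ((shiftWeight r n : ℂ) • (shift ^ (n + 1) * star shift ^ n)) =
      if n ≤ k then (shiftWeight r n : ℂ) • basisVec (k + 1) else 0 := by
    intro n
    change (shiftWeight r n : ℂ) • (shift ^ (n + 1)) ((star shift ^ n) (basisVec k)) = _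
    rw [star_shift_pow_basisVec]
    split_ifs with hn
    · rw [shift_pow_basisVec, show k - n + (n + 1) = k + 1 by omega]
    · rw [map_zero, smul_zero]
  simp only [hterm]
  have hfin : HasSum (fun n => if n ≤ k then (shiftWeight r n : ℂ) • basisVec (k + 1) else 0)
      (∑ n ∈ Finset.range (k + 1),
        if n ≤ k then (shiftWeight r n : ℂ) • basisVec (k + 1) else 0) :=
    hasSum_sum_of_ne_finset_zero fun n hn => if_neg (by simpa [Nat.lt_succ_iff] using hn)
  convert hfin using 1
  refine Finset.sum_congr rfl fun n hn => ?_
  rw [if_pos (Nat.lt_succ_iff.1 (Finset.mem_range.1 hn))]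
  rfl

end Quotient

end

theorem lemma3p2 (p q : Set.Ioo (0 : ℝ) 1) :
    ∃ (φ : SphereCStar p q ≃⋆ₐ[ℂ] ToeplitzQuotient) (A B : Toeplitz),
      (∀ k : ℕ, (A : ℓ²(ℕ, ℂ) →L[ℂ] ℓ²(ℕ, ℂ)) (lp.single 2 k 1) =
        ((√(1 - (q : ℝ) ^ (k + 1)) : ℝ) : ℂ) • lp.single 2 (k + 1) (1 : ℂ)) ∧
      (∀ k : ℕ, (B : ℓ²(ℕ, ℂ) →L[ℂ] ℓ²(ℕ, ℂ)) (lp.single 2 k 1) =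
        ((√(1 - (p : ℝ) ^ (k + 1)) : ℝ) : ℂ) • lp.single 2 (k + 1) (1 : ℂ)) ∧
      HasSum (fun n : ℕ => ((√(1 - (q : ℝ) ^ (n + 1)) - √(1 - (q : ℝ) ^ n) : ℝ) : ℂ) •
        (Toeplitz.s ^ (n + 1) * star Toeplitz.s ^ n)) A ∧
      HasSum (fun n : ℕ => ((√(1 - (p : ℝ) ^ (n + 1)) - √(1 - (p : ℝ) ^ n) : ℝ) : ℂ) •
        (Toeplitz.s ^ (n + 1) * star Toeplitz.s ^ n)) B ∧
      φ (SphereCStar.gen p q .a) = ToeplitzQuotient.mk (Toeplitz.tmul A 1) ∧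
      φ (SphereCStar.gen p q .b) = ToeplitzQuotient.mk (Toeplitz.tmul 1 B) := by
  obtain ⟨Φ, hΦ⟩ := exists_sphere_hom_of_quotient (p := p) (q := q) (m := ToeplitzQuotient.mk)
    fun _ => ToeplitzQuotient.mk_eq_zero
  have hnorm : ∀ x, ‖SpherePoly.univRep p q x‖ = ‖Φ x‖ := fun x =>
    le_antisymm (lp.norm_le_of_forall_le (norm_nonneg _) fun π =>
      norm_rep_le hΦ (fun y _ => ToeplitzQuotient.exists_norm_add_lt y) π x)
      (norm_le_norm_univRep Φ x)
  obtain ⟨φ, hφ⟩ := exists_starAlgEquiv_of_norm_eq (SpherePoly.univRep p q) Φ hnorm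
    (denseRange_sphere_hom hΦ ToeplitzQuotient.mk_surjective)
  have ha : weightedGen p q .a = Toeplitz.tmul (Toeplitz.weighted q) 1 :=
    Subtype.ext coe_weightedGen_a
  have hb : weightedGen p q .b = Toeplitz.tmul 1 (Toeplitz.weighted p) :=
    Subtype.ext coe_weightedGen_b
  exact ⟨φ, Toeplitz.weighted q, Toeplitz.weighted p, weightedShift_shift_single q,
    weightedShift_shift_single p, Toeplitz.hasSum_weighted q, Toeplitz.hasSum_weighted p,
    (hφ _ _).trans ((hΦ .a).trans (congrArg _ ha)), (hφ _ _).trans ((hΦ .b).trans (congrArg _ hb))⟩
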